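/- Let $d \ge 1$ be an integer. For a non-empty set $X \subseteq \mathbb{R}^d$ let $\dim X$ be the dimension of the affine span of $X$, and for $\vec v \in \mathbb{R}^d\setminus\{0\}$ let $\pi_{\vec v}$ be the orthogonal projection of $\mathbb{R}^d$ onto the hyperplane orthogonal to $\vec v$. For every real number $C$ there is a constant $K$, depending only on $d$ and $C$, such that the following holds. Let $A, B \subseteq \mathbb{R}^d$ be finite non-empty sets with $\dim A = d$, $|A| \ge |B|$ and \[ |A+B| \le |A| + \Big(d + \tfrac17\Big)|B| - C. \] Then for every $\vec v \in \mathbb{R}^d\setminus\{0\}$ (and so, in particular, for at least one such $\vec v$), either \[ |\pi_{\vec v}(A)| = d \quad\text{and}\quad |\pi_{\vec v}(B)| \in \{d, \dim B\}, \] or \[ |B| \le K\,\big(|\pi_{\vec v}(A)| + |\pi_{\vec v}(B)|\big). \] -/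

import Mathlib

open scoped Pointwise

noncomputable section

/-- The dimension of a set `A ⊆ ℝ^d`: the dimension of its affine span, that is, of the direction
of the affine span. -/
def affDim {d : ℕ} (A : Set (EuclideanSpace ℝ (Fin d))) : ℕ :=
  Module.finrank ℝ (affineSpan ℝ A).direction

/-- The hyperplane `H_v` orthogonal to `v`. -/
def hyperplane {d : ℕ} (v : EuclideanSpace ℝ (Fin d)) :
    Submodule ℝ (EuclideanSpace ℝ (Fin d)) :=
  (Submodule.span ℝ {v})ᗮ

/-- The orthogonal projection `π_v : ℝ^d → H_v`. -/
def proj {d : ℕ} (v : EuclideanSpace ℝ (Fin d)) :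
    EuclideanSpace ℝ (Fin d) → hyperplane v :=
  fun x => (hyperplane v).orthogonalProjectionOnto x

/-- The dichotomy for the direction `v`, with implied constant `K`: either `|π_v(A)| = d` and
`|π_v(B)| ∈ {d, dim B}`, or `|B| ≤ K (|π_v(A)| + |π_v(B)|)`. -/
def DirectionDichotomy {d : ℕ} (K : ℝ) (A B : Set (EuclideanSpace ℝ (Fin d)))
    (v : EuclideanSpace ℝ (Fin d)) : Prop :=
  ((proj v '' A).ncard = d ∧ ((proj v '' B).ncard = d ∨ (proj v '' B).ncard = affDim B)) ∨
    (B.ncard : ℝ) ≤ K * (((proj v '' A).ncard : ℝ) + ((proj v '' B).ncard : ℝ))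

end

/-! The proof projects along `v` and counts points of `A` and `B` in the fibres. Each fibre is a
finite subset of a line, so two fibres of sizes m and n have a sumset of size at least m + n - 1 =
(m - 1/2) + (n - 1/2). Hence |A+B| is at least `weight` of the two images: the sum over z of the
maximum of α(x) + β(y) over x + y = z, where α and β are fibre size minus 1/2 (`weight_fiberWt_le`).

The core is the gap theorem `gap_le_weight`. For probability weights the total is at least dim(dir A
+ dir B) + 2, and at least 1/6 more if one of the two sets is affinely dependent. In the hyperplane,
of dimension d - 1, a dependent image gives |A+B| ≥ |A| + (d + 1/6)|B| - (d + 1)(|π(A)| + |π(B)|).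
Against the hypothesis with 1/7, the surplus |B|/42 is bounded by the projection sizes. If both
images are independent, π(A) has exactly d points; either π is injective on B, so |B| = |π(B)|, or v
lies in the direction of B and π(B) has dim B points.

The gap theorem goes by induction on |A| + |B|, at a minimizing pair of weights. If all weights are
positive, the first-order condition (`sum_le_weight_of_minimizer`) is tested on uniform weights of
two faces. A linear tilt φ makes the top face X of α + φ span the same direction as A; Y is the top
of β + φ in one coset of `dir A`; each further coset met by B contributes 1 (`face_rate_le`).
Smaller faces are handled by induction, full faces by a Freiman-type sumset bound (`flat_bound`),
and independent faces of a dependent set by one further layer of sums (`extra_layer_bound`).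

If a weight vanishes, that point is deleted (`gap_le_of_zero`). Only the loss of dependence needs
care: `near_indep_bound` recovers 1/6 by counting representations in independent pairs. -/

open scoped Pointwise

noncomputable section

namespace SumsetGap

open Finset Module

section

variable {E : Type*} [AddCommGroup E] [Module ℝ E]

/-! ### Affine rank of finite sets -/

/-- The direction of the affine span of a finite set. -/
abbrev dir (A : Finset E) : Submodule ℝ E := vectorSpan ℝ (A : Set E)

/-- The dimension of the affine span of a finite set. -/
def rk (A : Finset E) : ℕ := finrank ℝ (dir A)

lemma sub_mem_dir {A : Finset E} {x y : E} (hx : x ∈ A) (hy : y ∈ A) : x - y ∈ dir A := by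
  simpa using vsub_mem_vectorSpan ℝ (mem_coe.2 hx) (mem_coe.2 hy)

lemma dir_le_iff {A : Finset E} {W : Submodule ℝ E} {p : E} (hp : p ∈ A) :
    dir A ≤ W ↔ ∀ x ∈ A, x - p ∈ W := by
  constructor
  · intro h x hx
    exact h (sub_mem_dir hx hp)
  · intro h
    rw [dir, vectorSpan_eq_span_vsub_set_right ℝ (mem_coe.2 hp), Submodule.span_le]
    rintro _ ⟨x, hx, rfl⟩
    simpa using h x hx

lemma dir_le_of_forall {A : Finset E} {W : Submodule ℝ E}
    (h : ∀ x ∈ A, ∀ y ∈ A, x - y ∈ W) : dir A ≤ W := by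
  rcases A.eq_empty_or_nonempty with rfl | ⟨p, hp⟩
  · simp [dir]
  · exact (dir_le_iff hp).2 fun x hx => h x hx p hp

lemma dir_mono {A B : Finset E} (h : A ⊆ B) : dir A ≤ dir B :=
  vectorSpan_mono ℝ (coe_subset.2 h)

lemma dir_insert_of_mem [DecidableEq E] {A : Finset E} {x p : E} (hp : p ∈ A)
    (h : x - p ∈ dir A) : dir (insert x A) = dir A := by
  refine le_antisymm ((dir_le_iff (mem_insert_of_mem hp)).2 ?_) (dir_mono (subset_insert _ _))
  intro y hy
  rcases mem_insert.1 hy with rfl | hy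
  · exact h
  · exact sub_mem_dir hy hp

lemma dir_insert [DecidableEq E] {A : Finset E} {x p : E} (hp : p ∈ A) :
    dir (insert x A) = dir A ⊔ Submodule.span ℝ {x - p} := by
  refine le_antisymm ((dir_le_iff (mem_insert_of_mem hp)).2 ?_)
    (sup_le (dir_mono (subset_insert _ _)) ?_)
  · intro y hy
    rcases mem_insert.1 hy with rfl | hy
    · exact Submodule.mem_sup_right (Submodule.mem_span_singleton_self _)
    · exact Submodule.mem_sup_left (sub_mem_dir hy hp)
  · rw [Submodule.span_singleton_le_iff_mem]
    exact sub_mem_dir (mem_insert_self _ _) (mem_insert_of_mem hp)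

lemma rk_singleton (x : E) : rk ({x} : Finset E) = 0 := by
  have h : dir ({x} : Finset E) = ⊥ := by rw [dir, coe_singleton, vectorSpan_singleton]
  rw [rk, h, finrank_bot]

lemma rk_add_one_le_card {A : Finset E} (hA : A.Nonempty) : rk A + 1 ≤ #A := by
  have : Nonempty A := hA.to_subtype
  have h := finrank_vectorSpan_range_add_one_le ℝ (fun x : A => (x : E))
  have h2 : Set.range (fun x : A => (x : E)) = (A : Set E) := by ext; simp
  rw [h2] at h
  simpa [rk] using h

lemma rk_pos [DecidableEq E] [FiniteDimensional ℝ E] {A : Finset E} (h : 2 ≤ #A) : 1 ≤ rk A := by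
  obtain ⟨x, hx, y, hy, hxy⟩ := one_lt_card.1 h
  by_contra hc
  have : dir A = ⊥ := Submodule.finrank_eq_zero.1 (by unfold rk at hc; omega)
  have h2 := sub_mem_dir hx hy
  rw [this, Submodule.mem_bot, sub_eq_zero] at h2
  exact hxy h2

lemma exists_subset_dir_eq (A : Finset E) (hA : A.Nonempty) :
    ∃ T ⊆ A, T.Nonempty ∧ dir T = dir A ∧ #T = rk A + 1 := by
  classical
  obtain ⟨t, htA, hspan, hind⟩ := exists_affineIndependent ℝ E (A : Set E)
  lift t to Finset E using A.finite_toSet.subset htA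
  have hdir : dir t = dir A := by
    rw [dir, dir, ← direction_affineSpan, hspan, direction_affineSpan]
  have hne : t.Nonempty := by
    rw [← coe_nonempty, ← affineSpan_nonempty ℝ, hspan, affineSpan_nonempty]
    exact hA
  refine ⟨t, coe_subset.1 htA, hne, hdir, ?_⟩
  have : Nonempty t := hne.to_subtype
  have hind' : AffineIndependent ℝ (fun x : t => (x : E)) := hind
  have h := hind'.finrank_vectorSpan_add_one
  have h2 : Set.range (fun x : t => (x : E)) = (t : Set E) := by ext; simp
  rw [h2] at h
  rw [rk, ← hdir, h]
  simp

/-- A linear functional separating a coloop from the remaining points. -/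
lemma exists_functional_of_rk_erase_lt [DecidableEq E] {A : Finset E} {e : E} (he : e ∈ A)
    (h : rk (A.erase e) < rk A) :
    ∃ (g : E →ₗ[ℝ] ℝ) (c : ℝ), ∀ x ∈ A, g x + c = if x = e then 1 else 0 := by
  rcases (A.erase e).eq_empty_or_nonempty with h0 | ⟨p, hp⟩
  · refine ⟨0, 1, fun x hx => ?_⟩
    have : x = e := by
      by_contra hne
      have := mem_erase.2 ⟨hne, hx⟩
      simp [h0] at this
    simp [this]
  · have hnot : e - p ∉ dir (A.erase e) := by
      intro hmem
      have := dir_insert_of_mem hp hmem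
      rw [insert_erase he] at this
      unfold rk at h
      rw [this] at h
      exact lt_irrefl _ h
    obtain ⟨f, hf, hker⟩ := Submodule.exists_le_ker_of_notMem hnot
    refine ⟨(f (e - p))⁻¹ • f, -((f (e - p))⁻¹ * f p), fun x hx => ?_⟩
    split_ifs with hxe
    · subst hxe
      have : f (x - p) = f x - f p := map_sub _ _ _
      simp only [LinearMap.smul_apply, smul_eq_mul]
      rw [← sub_eq_add_neg, ← mul_sub, ← this, inv_mul_cancel₀ hf]
    · have h1 : f (x - p) = 0 := hker (sub_mem_dir (mem_erase.2 ⟨hxe, hx⟩) hp)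
      rw [map_sub, sub_eq_zero] at h1
      simp [h1]

/-! ### Removing a top point from a sumset -/

/-- Removing the unique highest points of two sets decreases the sumset by at least `rk X + 1`. -/
lemma card_add_ge_of_top [DecidableEq E] {Γ : Type*} [AddCommGroup Γ] [LinearOrder Γ]
    [IsOrderedAddMonoid Γ] (l : E →+ Γ) {X Y : Finset E} {x₁ y₁ : E} (hx₁ : x₁ ∈ X)
    (hy₁ : y₁ ∈ Y) (hX : ∀ x ∈ X, x ≠ x₁ → l x < l x₁) (hY : ∀ y ∈ Y, y ≠ y₁ → l y < l y₁) :
    #(X.erase x₁ + Y.erase y₁) + rk X + 1 ≤ #(X + Y) := by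
  set S := X.erase x₁ + Y.erase y₁ with hS
  have hsub : S ⊆ X + Y := add_subset_add (erase_subset _ _) (erase_subset _ _)
  -- The lost sums, translated so that the top sum becomes 0, are shown to span `dir X`; together
  -- with 0 itself they number at least `rk X + 1`.
  set G := ((X + Y) \ S).image (fun z => z - (x₁ + y₁)) with hG
  have hcard : #G = #(X + Y) - #S := by
    rw [hG, card_image_of_injective _ (sub_left_injective), card_sdiff_of_subset hsub]
  have h0 : (0 : E) ∈ G := by
    refine mem_image.2 ⟨x₁ + y₁, mem_sdiff.2 ⟨add_mem_add hx₁ hy₁, ?_⟩, sub_self _⟩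
    intro hmem
    obtain ⟨x, hx, y, hy, hxy⟩ := mem_add.1 hmem
    have h1 := hX x (mem_of_mem_erase hx) (ne_of_mem_erase hx)
    have h2 := hY y (mem_of_mem_erase hy) (ne_of_mem_erase hy)
    have h3 := add_lt_add h1 h2
    rw [← map_add, ← map_add, hxy] at h3
    exact lt_irrefl _ h3
  set W := Submodule.span ℝ (G : Set E) with hW
  classical
  have key : ∀ t ∈ X.image (fun x => x - x₁) ∪ Y.image (fun y => y - y₁), t ∈ W := by
    by_contra! hc
    obtain ⟨t₀, ht₀, ht₀W⟩ := hc
    -- Take the highest generator outside `W`. If the corresponding sum survives in `S`, then `t`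
    -- splits into two negative vectors, both higher than `t` and so both in `W`.
    obtain ⟨t, ht, hmax⟩ := exists_max_image
      ((X.image (fun x => x - x₁) ∪ Y.image (fun y => y - y₁)).filter (· ∉ W)) l
      ⟨t₀, mem_filter.2 ⟨ht₀, ht₀W⟩⟩
    obtain ⟨htU, htW⟩ := mem_filter.1 ht
    have hdecomp : ∀ x' ∈ X, ∀ y' ∈ Y, x' ≠ x₁ → y' ≠ y₁ → t = (x' - x₁) + (y' - y₁) → False := by
      intro x' hx' y' hy' hx'1 hy'1 heq
      have h1 : l (x' - x₁) < 0 := by rw [map_sub]; exact sub_neg.2 (hX x' hx' hx'1)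
      have h2 : l (y' - y₁) < 0 := by rw [map_sub]; exact sub_neg.2 (hY y' hy' hy'1)
      have h3 : l t = l (x' - x₁) + l (y' - y₁) := by rw [heq, map_add]
      apply htW
      rw [heq]
      refine W.add_mem ?_ ?_
      · by_contra hn
        have := hmax (x' - x₁)
          (mem_filter.2 ⟨mem_union_left _ (mem_image_of_mem _ hx'), hn⟩)
        rw [h3] at this
        exact absurd ((add_lt_of_le_of_neg this h2)) (lt_irrefl _)
      · by_contra hn
        have := hmax (y' - y₁)
          (mem_filter.2 ⟨mem_union_right _ (mem_image_of_mem _ hy'), hn⟩)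
        rw [h3] at this
        exact absurd (add_lt_of_neg_of_le h1 this) (lt_irrefl _)
    have hgen : ∀ x ∈ X, ∀ y ∈ Y, t = (x - x₁) + (y - y₁) → False := by
      intro x hx y hy heq
      by_cases hz : x + y ∈ S
      · obtain ⟨x', hx', y', hy', hxy⟩ := mem_add.1 hz
        refine hdecomp x' (mem_of_mem_erase hx') y' (mem_of_mem_erase hy') (ne_of_mem_erase hx')
          (ne_of_mem_erase hy') ?_
        rw [heq, ← sub_eq_zero]
        rw [← sub_eq_zero] at hxy
        rw [← neg_eq_zero, ← hxy]
        abel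
      · apply htW
        refine Submodule.subset_span (mem_coe.2 (mem_image.2
          ⟨x + y, mem_sdiff.2 ⟨add_mem_add hx hy, hz⟩, ?_⟩))
        rw [heq]; abel
    rcases mem_union.1 htU with h | h
    · obtain ⟨x, hx, rfl⟩ := mem_image.1 h
      exact hgen x hx y₁ hy₁ (by simp)
    · obtain ⟨y, hy, rfl⟩ := mem_image.1 h
      exact hgen x₁ hx₁ y hy (by simp)
  have hle : dir X ≤ W := (dir_le_iff hx₁).2 fun x hx =>
    key _ (mem_union_left _ (mem_image_of_mem _ hx))
  have hle2 : dir X ≤ Submodule.span ℝ ((G.erase 0 : Finset E) : Set E) := by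
    refine hle.trans (le_of_eq ?_)
    rw [hW, coe_erase, Submodule.span_sdiff_singleton_zero]
  have h1 : rk X ≤ #(G.erase 0) :=
    (Submodule.finrank_mono hle2).trans (finrank_span_finset_le_card _)
  have h2 := card_erase_add_one h0
  have h3 := card_le_card hsub
  omega

variable [FiniteDimensional ℝ E]

/-! ### Monotonicity of the rank -/

lemma rk_mono {A B : Finset E} (h : A ⊆ B) : rk A ≤ rk B :=
  Submodule.finrank_mono (dir_mono h)

lemma dir_eq_of_rk_le {A B : Finset E} (h : A ⊆ B) (h2 : rk B ≤ rk A) : dir A = dir B :=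
  Submodule.eq_of_le_of_finrank_le (dir_mono h) h2

lemma rk_insert_le [DecidableEq E] (A : Finset E) (x : E) : rk (insert x A) ≤ rk A + 1 := by
  rcases A.eq_empty_or_nonempty with rfl | ⟨p, hp⟩
  · rw [insert_empty, rk_singleton]; exact Nat.zero_le _
  · unfold rk
    rw [dir_insert hp]
    refine (Submodule.finrank_add_le_finrank_add_finrank _ _).trans (Nat.add_le_add_left ?_ _)
    have h := finrank_span_finset_le_card (R := ℝ) ({x - p} : Finset E)
    rwa [coe_singleton, card_singleton] at h

lemma exists_rk_erase_eq [DecidableEq E] {A : Finset E} (h : rk A + 2 ≤ #A) :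
    ∃ x ∈ A, rk (A.erase x) = rk A := by
  have hA : A.Nonempty := card_pos.1 (by omega)
  obtain ⟨T, hTA, hT, hdir, hcard⟩ := exists_subset_dir_eq A hA
  obtain ⟨x, hx, hxT⟩ : ∃ x ∈ A, x ∉ T := by
    by_contra! hc
    have := card_le_card (show A ⊆ T from hc)
    omega
  refine ⟨x, hx, le_antisymm (rk_mono (erase_subset _ _)) ?_⟩
  calc rk A = rk T := by unfold rk; rw [hdir]
    _ ≤ _ := rk_mono (subset_erase.2 ⟨hTA, hxT⟩)

lemma card_erase_eq_of_indep [DecidableEq E] {A : Finset E} (h : #A = rk A + 1) {e : E}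
    (he : e ∈ A) (hne : (A.erase e).Nonempty) : #(A.erase e) = rk (A.erase e) + 1 := by
  have h1 := rk_insert_le (A.erase e) e
  rw [insert_erase he] at h1
  have h2 := rk_add_one_le_card hne
  have h3 := card_erase_add_one he
  omega

/-- Barycentric coordinates on an affinely independent set. -/
lemma exists_coord [DecidableEq E] {A : Finset E} (h : #A = rk A + 1) {e : E} (he : e ∈ A) :
    ∃ (g : E →ₗ[ℝ] ℝ) (c : ℝ), ∀ x ∈ A, g x + c = if x = e then 1 else 0 := by
  rcases (A.erase e).eq_empty_or_nonempty with h0 | hne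
  · refine ⟨0, 1, fun x hx => ?_⟩
    have : x = e := by
      by_contra hne
      have := mem_erase.2 ⟨hne, hx⟩
      simp [h0] at this
    simp [this]
  · apply exists_functional_of_rk_erase_lt he
    have := card_erase_eq_of_indep h he hne
    have h3 := card_erase_add_one he
    omega

/-- The barycentric coordinate of `a` takes the value 1 on `a - b`, which no difference starting
elsewhere attains. -/
lemma sub_eq_sub_of_indep [DecidableEq E] {A : Finset E} (h : #A = rk A + 1) {a b c d : E}
    (ha : a ∈ A) (hb : b ∈ A) (hc : c ∈ A) (hd : d ∈ A) (hab : a ≠ b) (hs : a - b = c - d) :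
    a = c := by
  obtain ⟨g, k, hg⟩ := exists_coord h ha
  have h1 := hg a ha
  have h2 := hg b hb
  have h3 := hg c hc
  have h4 := hg d hd
  have h5 : g a - g b = g c - g d := by rw [← map_sub, ← map_sub, hs]
  rw [if_pos rfl] at h1
  rw [if_neg hab.symm] at h2
  by_contra hne
  rw [if_neg (Ne.symm hne)] at h3
  split_ifs at h4 <;> linarith

/-! ### Lower bounds for the cardinality of a sumset -/

/-- A total order refinement of a linear functional, compatible with addition. -/
lemma exists_lex_hom (f : E →ₗ[ℝ] ℝ) :
    ∃ l : E →+ ℝ ×ₗ Lex (Fin (finrank ℝ E) → ℝ), Function.Injective l ∧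
      ∀ x y, l x ≤ l y → f x ≤ f y := by
  let e := (finBasis ℝ E).equivFun
  refine ⟨⟨⟨fun x => toLex (f x, toLex (e x)), ?_⟩, ?_⟩, ?_, ?_⟩
  · simp only [map_zero]; rfl
  · intro x y; simp only [map_add]; rfl
  · intro x y hxy
    have h1 : (f x, toLex (e x)) = (f y, toLex (e y)) := toLex.injective hxy
    have h2 := congrArg Prod.snd h1
    exact e.injective (toLex.injective h2)
  · intro x y hxy
    rcases (Prod.Lex.le_iff).1 hxy with h | h
    · exact le_of_lt h
    · exact le_of_eq h.1

/-- Peeling a top point must preserve the rank of `X` for the induction on the excess to run, so the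
direction is chosen to push every coloop below the other points. -/
lemma exists_noncoloop_top [DecidableEq E] {X Y : Finset E} (hX : rk X + 2 ≤ #X)
    (hY : Y.Nonempty) : ∃ x₁ ∈ X, ∃ y₁ ∈ Y, rk (X.erase x₁) = rk X ∧
      #(X.erase x₁ + Y.erase y₁) + rk X + 1 ≤ #(X + Y) := by
  set Co := X.filter (fun e => rk (X.erase e) < rk X) with hCo
  have hex : ∀ e ∈ Co, ∃ (g : E →ₗ[ℝ] ℝ) (c : ℝ), ∀ x ∈ X, g x + c = if x = e then 1 else 0 :=
    fun e he => exists_functional_of_rk_erase_lt (mem_filter.1 he).1 (mem_filter.1 he).2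
  choose! g c hg using hex
  -- On `X` this functional is a constant, lowered by 1 exactly at the coloops. Its lexicographic
  -- refinement makes the maxima unique.
  set f : E →ₗ[ℝ] ℝ := -∑ e ∈ Co, g e with hf
  have hfx : ∀ x ∈ X, f x = (∑ e ∈ Co, c e) - if x ∈ Co then 1 else 0 := by
    intro x hx
    have h1 : ∑ e ∈ Co, (g e x + c e) = if x ∈ Co then 1 else 0 := by
      rw [sum_congr rfl fun e he => hg e he x hx]
      simp
    rw [sum_add_distrib] at h1
    rw [hf, LinearMap.neg_apply, LinearMap.sum_apply]
    linarith
  obtain ⟨l, hinj, hl⟩ := exists_lex_hom f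
  obtain ⟨x₁, hx₁, hmx⟩ := exists_max_image X l (card_pos.1 (by omega))
  obtain ⟨y₁, hy₁, hmy⟩ := exists_max_image Y l hY
  refine ⟨x₁, hx₁, y₁, hy₁, ?_, card_add_ge_of_top l hx₁ hy₁
    (fun x hx hne => lt_of_le_of_ne (hmx x hx) (hinj.ne hne))
    (fun y hy hne => lt_of_le_of_ne (hmy y hy) (hinj.ne hne))⟩
  obtain ⟨x₂, hx₂, hrk⟩ := exists_rk_erase_eq hX
  by_contra hne
  have hco : x₁ ∈ Co := mem_filter.2 ⟨hx₁, lt_of_le_of_ne (rk_mono (erase_subset _ _)) hne⟩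
  have hco2 : x₂ ∉ Co := fun h => (mem_filter.1 h).2.ne hrk
  have h := hl _ _ (hmx x₂ hx₂)
  rw [hfx _ hx₁, hfx _ hx₂, if_pos hco, if_neg hco2] at h
  linarith

/-- Two distinct translates of an independent set share at most one point, so the j-th translate
adds at least `#X - (j - 1)` sums. -/
lemma card_add_ge_of_indep [DecidableEq E] {X : Finset E} (hX : #X = rk X + 1) (Y : Finset E) :
    2 * (#X : ℤ) * #Y - #Y * (#Y - 1) ≤ 2 * #(X + Y) := by
  induction Y using Finset.induction_on with
  | empty => simp
  | insert y Y hy ih =>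
    have h1 : X + insert y Y = (X + Y) ∪ (X + {y}) := by
      rw [insert_eq, add_union, union_comm]
    have h2 : #((X + Y) ∩ (X + {y})) ≤ #Y := by
      have hsub : (X + Y) ∩ (X + {y}) ⊆ Y.biUnion fun y' => (X + {y'}) ∩ (X + {y}) := by
        intro z hz
        obtain ⟨hz1, hz2⟩ := mem_inter.1 hz
        obtain ⟨x', hx', y', hy', rfl⟩ := mem_add.1 hz1
        exact mem_biUnion.2 ⟨y', hy', mem_inter.2 ⟨add_mem_add hx' (mem_singleton_self _), hz2⟩⟩
      refine (card_le_card hsub).trans ((card_biUnion_le_card_mul _ _ 1 ?_).trans (by simp))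
      intro y' hy'
      rw [card_le_one]
      intro u hu v hv
      simp only [mem_inter, mem_add, mem_singleton, exists_eq_left] at hu hv
      obtain ⟨⟨a, ha, rfl⟩, b, hb, hab⟩ := hu
      obtain ⟨⟨a', ha', rfl⟩, b', hb', hab'⟩ := hv
      have hne : a ≠ b := by
        rintro rfl
        exact hy (add_left_cancel hab ▸ hy')
      have : a = a' := sub_eq_sub_of_indep hX ha hb ha' hb' hne (by
        have e1 : a - b = y - y' := by
          rw [sub_eq_sub_iff_add_eq_add, ← hab, add_comm]
        have e2 : a' - b' = y - y' := by
          rw [sub_eq_sub_iff_add_eq_add, ← hab', add_comm]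
        rw [e1, e2])
      rw [this]
    have h3 := card_union_add_card_inter (X + Y) (X + {y})
    have h4 : #(X + {y}) = #X := by
      rw [add_singleton]
      exact card_image_of_injective _ (add_left_injective y)
    rw [h1, card_insert_of_notMem hy]
    push_cast
    have h5 : (#(X + Y) : ℤ) + #X ≤ #(X + Y ∪ (X + {y})) + #Y := by
      rw [← h4]; exact_mod_cast (by omega)
    linarith

/-- Lower bounds for `|X + Y|` when `|Y| ≤ |X|`, in terms of the rank and the excess of `X`. -/
lemma card_add_ge [DecidableEq E] (r : ℕ) : ∀ {X Y : Finset E}, #X = rk X + 1 + r → Y.Nonempty →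
    #Y ≤ #X → ((#Y ≤ r + 1 → (#X : ℤ) + rk X * (#Y - 1) ≤ #(X + Y)) ∧
      (r + 1 ≤ #Y → 2 * ((rk X : ℤ) + 1) * r + 2 * (rk X + 1) * (#Y - r) -
        (#Y - r) * (#Y - r - 1) ≤ 2 * #(X + Y))) := by
  induction r with
  | zero =>
    intro X Y hX hY hYX
    constructor
    · intro h
      have : #Y = 1 := le_antisymm h hY.card_pos
      have h2 := card_le_card_add_right (s := X) hY
      rw [this]
      simpa using h2
    · intro _
      have := card_add_ge_of_indep (X := X) (by omega) Y
      rw [hX] at this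
      push_cast at this ⊢
      linarith
  | succ r ih =>
    intro X Y hX hY hYX
    have hY1 := hY.card_pos
    rcases Nat.lt_or_ge 1 (#Y) with h1 | h1
    · obtain ⟨x₁, hx₁, y₁, hy₁, hrk, hN⟩ := exists_noncoloop_top (X := X) (Y := Y) (by omega) hY
      have e1 := card_erase_add_one hx₁
      have e2 := card_erase_add_one hy₁
      have hne : (Y.erase y₁).Nonempty := card_pos.1 (by omega)
      obtain ⟨i1, i2⟩ := ih (X := X.erase x₁) (Y := Y.erase y₁) (by omega) hne (by omega)
      rw [hrk] at i1 i2
      have c1 : (#X : ℤ) = #(X.erase x₁) + 1 := by exact_mod_cast e1.symm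
      have c2 : (#Y : ℤ) = #(Y.erase y₁) + 1 := by exact_mod_cast e2.symm
      have c3 : (#(X.erase x₁ + Y.erase y₁) : ℤ) + rk X + 1 ≤ #(X + Y) := by exact_mod_cast hN
      constructor
      · intro h
        have := i1 (by omega)
        rw [c1, c2]
        linarith
      · intro h
        have := i2 (by omega)
        rw [c2]
        push_cast
        linarith
    · have : #Y = 1 := le_antisymm h1 hY1
      have h2 := card_le_card_add_right (s := X) hY
      constructor
      · intro _
        rw [this]
        simpa using h2
      · intro h
        omega

lemma flat_bound_aux {k x y N r : ℝ} (hk : 0 ≤ k) (hr : 0 ≤ r) (hx : x = k + 1 + r) (hy : 1 ≤ y)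
    (hyx : y ≤ x) (h2 : 2 * (k + 1) * r + 2 * (k + 1) * (y - r) - (y - r) * (y - r - 1) ≤ 2 * N)
    (hry : r + 1 ≤ y) : (k + 2) * x * y + r * k * y ≤ N * (x + y) := by
  -- In terms of `w` and `s`, `y ≥ r + 1` and `y ≤ x` become sign conditions, and the difference
  -- becomes a polynomial with nonnegative terms.
  obtain ⟨w, rfl⟩ : ∃ w, y = r + 1 + w := ⟨y - r - 1, by ring⟩
  obtain ⟨s, rfl⟩ : ∃ s, k = w + s := ⟨k - w, by ring⟩
  subst hx
  have hw : 0 ≤ w := by linarith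
  have hs : 0 ≤ s := by linarith
  have h3 := mul_le_mul_of_nonneg_right h2
    (show 0 ≤ (w + s + 1 + r) + (r + 1 + w) by linarith)
  have h4 : 0 ≤ (w + 1) * w * s + 2 * r * (w * s) := by positivity
  nlinarith

/-- The uniform-weight inequality for a pair of sets with `|Y| ≤ |X|`. -/
lemma flat_bound [DecidableEq E] {X Y : Finset E} (hX : X.Nonempty) (hY : Y.Nonempty)
    (hYX : #Y ≤ #X) :
    ((rk X : ℝ) + 2 + if rk X + 2 ≤ #X then 1 / 6 else 0) * (#X * #Y) ≤
      #(X + Y) * ((#X : ℝ) + #Y) := by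
  obtain ⟨r, hr⟩ := Nat.exists_eq_add_of_le (rk_add_one_le_card hX)
  obtain ⟨h1, h2⟩ := card_add_ge r hr hY hYX
  have hxr : (#X : ℝ) = rk X + 1 + r := by exact_mod_cast hr
  have hy1 : (1 : ℝ) ≤ #Y := by exact_mod_cast hY.card_pos
  have hyx : (#Y : ℝ) ≤ #X := by exact_mod_cast hYX
  have hk0 : (0 : ℝ) ≤ rk X := by positivity
  have hr0 : (0 : ℝ) ≤ r := by positivity
  rcases Nat.lt_or_ge (#Y) (r + 1) with hlt | hge
  · have h1' : (#X : ℝ) + rk X * (#Y - 1) ≤ #(X + Y) := by exact_mod_cast h1 hlt.le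
    have hs : (#Y : ℝ) + 1 ≤ r + 1 := by exact_mod_cast hlt
    have hdep : rk X + 2 ≤ #X := by have := hY.card_pos; omega
    have hk : (1 : ℝ) ≤ rk X := by exact_mod_cast rk_pos (A := X) (by omega)
    rw [if_pos hdep]
    refine le_trans ?_ (mul_le_mul_of_nonneg_right h1' (by linarith))
    generalize (#X : ℝ) = x at *
    generalize (#Y : ℝ) = y at *
    generalize (rk X : ℝ) = k at *
    obtain ⟨s, hs⟩ : ∃ s, (r : ℝ) = y + s := ⟨r - y, by ring⟩
    rw [hs] at hxr
    subst hxr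
    have hs0 : 0 ≤ s := by linarith
    have e1 : 0 ≤ (k - 1) * (6 * y ^ 2 - 7 * y + 6 * (s + 1)) :=
      mul_nonneg (by linarith) (by nlinarith [sq_nonneg (y - 1)])
    nlinarith [mul_nonneg hs0 (by linarith : 0 ≤ y), sq_nonneg (y - 1)]
  · have h2' : 2 * ((rk X : ℝ) + 1) * r + 2 * (rk X + 1) * (#Y - r) -
        (#Y - r) * (#Y - r - 1) ≤ 2 * #(X + Y) := by exact_mod_cast h2 hge
    have h3 := flat_bound_aux hk0 hr0 hxr hy1 hyx h2' (by exact_mod_cast hge)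
    refine le_trans ?_ h3
    split_ifs with hdep
    · have hk : (1 : ℝ) ≤ rk X := by exact_mod_cast rk_pos (A := X) (by omega)
      have hr1 : (1 : ℝ) ≤ r := by exact_mod_cast (by omega : 1 ≤ r)
      -- The surplus `r * k * y` of the auxiliary bound pays for `x * y / 6`, because `k + 1 + r ≤ 3
      -- * r * k` once `k` and `r` are at least 1.
      have : (#X : ℝ) ≤ 6 * (r * rk X) := by nlinarith
      nlinarith
    · have := mul_nonneg (mul_nonneg hr0 hk0) (by linarith : (0 : ℝ) ≤ #Y)
      nlinarith

end

section

/-! ### Weighted sumsets -/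

section Probability

variable {E : Type*}

/-- Probability weights on a finite set. -/
structure IsWt (A : Finset E) (α : E → ℝ) : Prop where
  nonneg : ∀ x ∈ A, 0 ≤ α x
  sum_eq : ∑ x ∈ A, α x = 1

variable {A : Finset E} {α : E → ℝ}

lemma IsWt.le_one (h : IsWt A α) {x : E} (hx : x ∈ A) : α x ≤ 1 :=
  h.sum_eq ▸ single_le_sum h.nonneg hx

variable [DecidableEq E]

lemma IsWt.erase {x : E} (h : IsWt A α) (hx : x ∈ A) (h0 : α x = 0) : IsWt (A.erase x) α where
  nonneg y hy := h.nonneg y (mem_of_mem_erase hy)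
  sum_eq := by
    rw [← h.sum_eq, ← add_sum_erase A α hx, h0, zero_add]

/-- The uniform probability weight on a subset. -/
def unif (X : Finset E) (x : E) : ℝ := if x ∈ X then (#X : ℝ)⁻¹ else 0

lemma unif_nonneg (X : Finset E) (x : E) : 0 ≤ unif X x := by
  unfold unif; split_ifs <;> positivity

lemma unif_of_mem {X : Finset E} {x : E} (hx : x ∈ X) : unif X x = (#X : ℝ)⁻¹ := if_pos hx

lemma isWt_unif {X : Finset E} (hX : X.Nonempty) (hXA : X ⊆ A) : IsWt A (unif X) where
  nonneg x _ := unif_nonneg X x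
  sum_eq := by
    have : (#X : ℝ) ≠ 0 := by exact_mod_cast hX.card_pos.ne'
    have h := sum_subset hXA (f := unif X) fun x _ hx => if_neg hx
    rw [← h, sum_congr rfl fun x hx => unif_of_mem hx]
    simp [this]

/-- Pinning the weights to 0 off `A` puts them in a product of compact intervals, even though the
index set `E` is infinite. -/
lemma isCompact_weights (A : Finset E) :
    IsCompact {α : E → ℝ | (∀ x, α x ∈ Set.Icc (0 : ℝ) (if x ∈ A then 1 else 0)) ∧
      ∑ x ∈ A, α x = 1} := by
  have h1 : IsCompact (Set.univ.pi fun x : E => Set.Icc (0 : ℝ) (if x ∈ A then 1 else 0)) :=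
    isCompact_univ_pi fun _ => isCompact_Icc
  have h2 : IsClosed {α : E → ℝ | ∑ x ∈ A, α x = 1} :=
    isClosed_eq (by fun_prop) continuous_const
  convert h1.inter_right h2 using 1
  ext α
  simp only [Set.mem_ofPred_eq, Set.mem_inter_iff, Set.mem_univ_pi]

end Probability

section Weights

variable {E : Type*} [AddCommGroup E] [DecidableEq E]

/-- The pairs in `A × B` with sum `z`. -/
def fib (A B : Finset E) (z : E) : Finset (E × E) :=
  (A ×ˢ B).filter fun p => p.1 + p.2 = z

lemma mem_fib {A B : Finset E} {z x y : E} :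
    (x, y) ∈ fib A B z ↔ x ∈ A ∧ y ∈ B ∧ x + y = z := by
  simp [fib, and_assoc]

/-- The largest weight of a representation `z = x + y`. -/
def val (A B : Finset E) (α β : E → ℝ) (z : E) : ℝ :=
  if h : (fib A B z).Nonempty then (fib A B z).sup' h fun p => α p.1 + β p.2 else 0

/-- The total weight of the sumset `A + B`. -/
def weight (A B : Finset E) (α β : E → ℝ) : ℝ :=
  ∑ z ∈ A + B, val A B α β z

variable {A B : Finset E} {α β : E → ℝ}

lemma le_val {x y z : E} (hx : x ∈ A) (hy : y ∈ B) (hz : x + y = z) :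
    α x + β y ≤ val A B α β z := by
  have hm : (x, y) ∈ fib A B z := mem_fib.2 ⟨hx, hy, hz⟩
  rw [val, dif_pos ⟨_, hm⟩]
  exact le_sup' (fun p : E × E => α p.1 + β p.2) hm

lemma exists_val {z : E} (hz : z ∈ A + B) :
    ∃ x ∈ A, ∃ y ∈ B, x + y = z ∧ val A B α β z = α x + β y := by
  obtain ⟨x, hx, y, hy, hxy⟩ := mem_add.1 hz
  have hm : (fib A B z).Nonempty := ⟨(x, y), mem_fib.2 ⟨hx, hy, hxy⟩⟩
  obtain ⟨⟨x', y'⟩, hp, he⟩ := exists_mem_eq_sup' hm (fun p : E × E => α p.1 + β p.2)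
  obtain ⟨h1, h2, h3⟩ := mem_fib.1 hp
  exact ⟨x', h1, y', h2, h3, by rw [val, dif_pos hm, he]⟩

lemma val_le_iff {z : E} (hz : z ∈ A + B) {c : ℝ} :
    val A B α β z ≤ c ↔ ∀ x ∈ A, ∀ y ∈ B, x + y = z → α x + β y ≤ c := by
  constructor
  · intro h x hx y hy hxy
    exact (le_val hx hy hxy).trans h
  · intro h
    obtain ⟨x, hx, y, hy, hxy, he⟩ := exists_val (α := α) (β := β) hz
    rw [he]
    exact h x hx y hy hxy

lemma val_mono_set {A' B' : Finset E} (hA : A' ⊆ A) (hB : B' ⊆ B) {z : E} (hz : z ∈ A' + B') :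
    val A' B' α β z ≤ val A B α β z :=
  (val_le_iff hz).2 fun _ hx _ hy hxy => le_val (hA hx) (hB hy) hxy

lemma val_mono {α' β' : E → ℝ} (hα : ∀ x ∈ A, α x ≤ α' x) (hβ : ∀ y ∈ B, β y ≤ β' y) {z : E}
    (hz : z ∈ A + B) : val A B α β z ≤ val A B α' β' z :=
  (val_le_iff hz).2 fun x hx y hy hxy =>
    (add_le_add (hα x hx) (hβ y hy)).trans (le_val hx hy hxy)

lemma val_nonneg (hα : ∀ x ∈ A, 0 ≤ α x) (hβ : ∀ y ∈ B, 0 ≤ β y) {z : E} (hz : z ∈ A + B) :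
    0 ≤ val A B α β z := by
  obtain ⟨x, hx, y, hy, hxy⟩ := mem_add.1 hz
  exact (add_nonneg (hα x hx) (hβ y hy)).trans (le_val hx hy hxy)

lemma weight_mono {α' β' : E → ℝ} (hα : ∀ x ∈ A, α x ≤ α' x) (hβ : ∀ y ∈ B, β y ≤ β' y) :
    weight A B α β ≤ weight A B α' β' :=
  sum_le_sum fun _ hz => val_mono hα hβ hz

lemma weight_congr {α' β' : E → ℝ} (hα : ∀ x ∈ A, α x = α' x) (hβ : ∀ y ∈ B, β y = β' y) :
    weight A B α β = weight A B α' β' :=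
  le_antisymm (weight_mono (fun x hx => (hα x hx).le) fun y hy => (hβ y hy).le)
    (weight_mono (fun x hx => (hα x hx).ge) fun y hy => (hβ y hy).ge)

lemma weight_comm (A B : Finset E) (α β : E → ℝ) : weight A B α β = weight B A β α := by
  have h : ∀ {A B : Finset E} {α β : E → ℝ}, weight A B α β ≤ weight B A β α := by
    intro A B α β
    rw [weight, weight, add_comm B A]
    refine sum_le_sum fun z hz => (val_le_iff hz).2 fun x hx y hy hxy => ?_
    rw [add_comm (α x)]
    exact le_val hy hx (by rw [add_comm, hxy])
  exact le_antisymm h h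

lemma weight_smul_le {c : ℝ} (hc : 0 ≤ c) :
    weight A B (fun x => c * α x) (fun y => c * β y) ≤ c * weight A B α β := by
  rw [weight, weight, mul_sum]
  refine sum_le_sum fun z hz => (val_le_iff hz).2 fun x hx y hy hxy => ?_
  rw [← mul_add]
  exact mul_le_mul_of_nonneg_left (le_val hx hy hxy) hc

lemma sum_le_weight (hα : ∀ x ∈ A, 0 ≤ α x) (hβ : ∀ y ∈ B, 0 ≤ β y) {S : Finset E}
    (hS : S ⊆ A + B) {L : E → ℝ} (hL : ∀ z ∈ S, L z ≤ val A B α β z) :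
    ∑ z ∈ S, L z ≤ weight A B α β :=
  (sum_le_sum hL).trans (sum_le_sum_of_subset_of_nonneg hS fun _ hz _ => val_nonneg hα hβ hz)

lemma weight_le_of_subset (hα : ∀ x ∈ A, 0 ≤ α x) (hβ : ∀ y ∈ B, 0 ≤ β y) {A' : Finset E}
    (hA : A' ⊆ A) : weight A' B α β ≤ weight A B α β :=
  sum_le_weight hα hβ (add_subset_add_right hA) fun _ hz => val_mono_set hA subset_rfl hz

lemma weight_add_sum_le_of_disjoint (hα : ∀ x ∈ A, 0 ≤ α x) (hβ : ∀ y ∈ B, 0 ≤ β y) {x : E}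
    (hx : x ∈ A) (h : ∀ y ∈ B, x + y ∉ A.erase x + B) :
    weight (A.erase x) B α β + ∑ y ∈ B, β y ≤ weight A B α β := by
  have hd : Disjoint (A.erase x + B) (B.image (x + ·)) := by
    rw [disjoint_right]
    intro z hz
    obtain ⟨y, hy, rfl⟩ := mem_image.1 hz
    exact h y hy
  have hs : ∑ z ∈ B.image (x + ·), val A B α β z = ∑ y ∈ B, val A B α β (x + y) :=
    sum_image fun y _ y' _ hyy => add_left_cancel hyy
  have h1 : weight (A.erase x) B α β ≤ ∑ z ∈ A.erase x + B, val A B α β z :=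
    sum_le_sum fun _ hz => val_mono_set (erase_subset _ _) subset_rfl hz
  have h2 : ∑ y ∈ B, β y ≤ ∑ y ∈ B, val A B α β (x + y) :=
    sum_le_sum fun y hy => (le_add_of_nonneg_left (hα x hx)).trans (le_val hx hy rfl)
  calc _ ≤ ∑ z ∈ A.erase x + B ∪ B.image (x + ·), val A B α β z := by
        rw [sum_union hd, hs]; exact add_le_add h1 h2
    _ ≤ _ := sum_le_weight hα hβ (union_subset (add_subset_add_right (erase_subset _ _))
        (by
          intro z hz
          obtain ⟨y, hy, rfl⟩ := mem_image.1 hz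
          exact add_mem_add hx hy)) fun _ _ => le_rfl

lemma weight_unif {X Y : Finset E} :
    weight X Y (unif X) (unif Y) = #(X + Y) * ((#X : ℝ)⁻¹ + (#Y : ℝ)⁻¹) := by
  rw [weight, sum_congr rfl fun z hz => ?_, sum_const, nsmul_eq_mul]
  obtain ⟨x, hx, y, hy, -, h⟩ := exists_val (α := unif X) (β := unif Y) hz
  rw [h, unif_of_mem hx, unif_of_mem hy]

lemma continuous_weight (A B : Finset E) :
    Continuous fun p : (E → ℝ) × (E → ℝ) => weight A B p.1 p.2 := by
  refine continuous_finsetSum _ fun z _ => ?_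
  unfold val
  split_ifs with h
  · refine Continuous.finset_sup'_apply h fun p _ => ?_
    fun_prop
  · fun_prop

lemma exists_minimizer (hA : A.Nonempty) (hB : B.Nonempty) :
    ∃ α β : E → ℝ, IsWt A α ∧ IsWt B β ∧
      ∀ α' β' : E → ℝ, IsWt A α' → IsWt B β' → weight A B α β ≤ weight A B α' β' := by
  have hmem : ∀ {A : Finset E} {α : E → ℝ}, IsWt A α → (fun x => if x ∈ A then α x else 0) ∈
      {α : E → ℝ | (∀ x, α x ∈ Set.Icc (0 : ℝ) (if x ∈ A then 1 else 0)) ∧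
        ∑ x ∈ A, α x = 1} := by
    intro A α h
    refine ⟨fun x => ?_, ?_⟩
    · by_cases hx : x ∈ A
      · simpa [hx] using ⟨h.nonneg x hx, h.le_one hx⟩
      · simp [hx]
    · rw [← h.sum_eq]
      exact sum_congr rfl fun x hx => if_pos hx
  obtain ⟨⟨α, β⟩, ⟨hα, hβ⟩, hmin⟩ := ((isCompact_weights A).prod
    (isCompact_weights B)).exists_isMinOn
      ⟨(_, _), hmem (isWt_unif hA subset_rfl), hmem (isWt_unif hB subset_rfl)⟩
      (continuous_weight A B).continuousOn
  refine ⟨α, β, ⟨fun x _ => (hα.1 x).1, hα.2⟩, ⟨fun x _ => (hβ.1 x).1, hβ.2⟩, ?_⟩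
  intro α' β' hα' hβ'
  have h := hmin (Set.mk_mem_prod (hmem hα') (hmem hβ'))
  exact h.trans (le_of_eq (weight_congr (fun x hx => if_pos hx) fun x hx => if_pos hx))

/-- First-order condition at a positive minimizer. -/
lemma sum_le_weight_of_minimizer (hα : IsWt A α) (hβ : IsWt B β) (hα0 : ∀ x ∈ A, 0 < α x)
    (hβ0 : ∀ y ∈ B, 0 < β y)
    (hmin : ∀ α' β' : E → ℝ, IsWt A α' → IsWt B β' → weight A B α β ≤ weight A B α' β')
    {ρ σ L : E → ℝ} (hρ : IsWt A ρ) (hσ : IsWt B σ)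
    (hL : ∀ x ∈ A, ∀ y ∈ B, val A B α β (x + y) = α x + β y → L (x + y) ≤ ρ x + σ y) :
    ∑ z ∈ A + B, L z ≤ weight A B α β := by
  have hsmall : ∀ u v : ℝ, 0 < u → ∀ᶠ ε in nhdsWithin (0 : ℝ) (Set.Ioi 0), ε * v < u := by
    intro u v hu
    have h1 : Filter.Tendsto (fun ε : ℝ => ε * v) (nhds 0) (nhds 0) := by
      simpa using (continuous_mul_const v).tendsto 0
    exact (h1.eventually (gt_mem_nhds hu)).filter_mono nhdsWithin_le_nhds
  have e1 : ∀ᶠ ε in nhdsWithin (0 : ℝ) (Set.Ioi 0), ∀ x ∈ A, ε * ρ x < α x :=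
    (Filter.eventually_all_finset A).2 fun x hx => hsmall _ _ (hα0 x hx)
  have e2 : ∀ᶠ ε in nhdsWithin (0 : ℝ) (Set.Ioi 0), ∀ y ∈ B, ε * σ y < β y :=
    (Filter.eventually_all_finset B).2 fun y hy => hsmall _ _ (hβ0 y hy)
  -- Tight pairs satisfy this by `hL`; the others have a strictly positive margin, which absorbs a
  -- small `ε`.
  have e3 : ∀ᶠ ε in nhdsWithin (0 : ℝ) (Set.Ioi 0), ∀ x ∈ A, ∀ y ∈ B,
      (α x - ε * ρ x) + (β y - ε * σ y) ≤ val A B α β (x + y) - ε * L (x + y) := by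
    refine (Filter.eventually_all_finset A).2 fun x hx =>
      (Filter.eventually_all_finset B).2 fun y hy => ?_
    rcases (le_val (α := α) (β := β) hx hy rfl).eq_or_lt with h | h
    · filter_upwards [self_mem_nhdsWithin] with ε hε
      have := mul_le_mul_of_nonneg_left (hL x hx y hy h.symm) (le_of_lt hε)
      linarith
    · filter_upwards [hsmall _ (L (x + y) - ρ x - σ y) (sub_pos.2 h)] with ε hε
      linarith
  obtain ⟨ε, h1, h2, h3, h4, h5⟩ := (e1.and (e2.and (e3.and
    ((hsmall 1 1 one_pos).and self_mem_nhdsWithin)))).exists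
  have hε : 0 < ε := h5
  rw [mul_one] at h4
  have hpos : 0 < 1 - ε := by linarith
  have hw : ∀ {A : Finset E} {α ρ : E → ℝ}, IsWt A α → IsWt A ρ → (∀ x ∈ A, ε * ρ x < α x) →
      IsWt A fun x => (1 - ε)⁻¹ * (α x - ε * ρ x) := by
    intro A α ρ hα hρ h
    refine ⟨fun x hx => mul_nonneg (inv_nonneg.2 hpos.le) (sub_nonneg.2 (h x hx).le), ?_⟩
    rw [← mul_sum, sum_sub_distrib, ← mul_sum, hα.sum_eq, hρ.sum_eq, mul_one,
      inv_mul_cancel₀ hpos.ne']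
  -- Minimality against the renormalised weights `(α - ε ρ) / (1 - ε)` and `(β - ε σ) / (1 - ε)`: a
  -- drop of `ε * ∑ L` cannot exceed `ε` times the minimum.
  have h6 := (hmin _ _ (hw hα hρ h1) (hw hβ hσ h2)).trans
    (weight_smul_le (A := A) (B := B) (inv_nonneg.2 hpos.le))
  rw [inv_mul_eq_div, le_div_iff₀ hpos] at h6
  have h7 : weight A B (fun x => α x - ε * ρ x) (fun y => β y - ε * σ y) ≤
      weight A B α β - ε * ∑ z ∈ A + B, L z := by
    rw [weight, weight, mul_sum, ← sum_sub_distrib]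
    refine sum_le_sum fun z hz => (val_le_iff hz).2 fun x hx y hy hxy => ?_
    rw [← hxy]
    exact h3 x hx y hy
  have h8 : ε * ∑ z ∈ A + B, L z ≤ ε * weight A B α β := by linarith
  exact le_of_mul_le_mul_left h8 hε

end Weights

end

section

variable {E : Type*} [AddCommGroup E] [Module ℝ E] [FiniteDimensional ℝ E] [DecidableEq E]

/-! ### Faces of a lifted configuration -/

/-- A pivot on the upper hull of the graph of `α`: tilt along a functional that is constant on the
current face until a new point reaches the top level. -/
lemma exists_face_rk_lt {A : Finset E} (α : E → ℝ) {φ : E →ₗ[ℝ] ℝ} {s : ℝ}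
    (hs : ∀ x ∈ A, α x + φ x ≤ s) (hne : (A.filter fun x => α x + φ x = s).Nonempty)
    (hlt : rk (A.filter fun x => α x + φ x = s) < rk A) :
    ∃ (φ' : E →ₗ[ℝ] ℝ) (s' : ℝ), (∀ x ∈ A, α x + φ' x ≤ s') ∧
      (A.filter fun x => α x + φ' x = s').Nonempty ∧
      rk (A.filter fun x => α x + φ x = s) < rk (A.filter fun x => α x + φ' x = s') := by
  set X := A.filter fun x => α x + φ x = s with hX
  obtain ⟨p, hp⟩ := hne
  have hpA := (mem_filter.1 hp).1
  obtain ⟨e, he, hep⟩ : ∃ e ∈ A, e - p ∉ dir X := by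
    by_contra! hc
    exact absurd (Submodule.finrank_mono ((dir_le_iff hpA).2 hc)) (not_le.2 hlt)
  obtain ⟨ψ, hψe, hψX⟩ : ∃ ψ : E →ₗ[ℝ] ℝ, 0 < ψ (e - p) ∧ dir X ≤ LinearMap.ker ψ := by
    obtain ⟨f, hf, hker⟩ := Submodule.exists_le_ker_of_notMem hep
    rcases lt_or_gt_of_ne hf with h | h
    · refine ⟨-f, by simpa using h, fun v hv => ?_⟩
      have := hker hv
      simpa using this
    · exact ⟨f, h, hker⟩
  have hXψ : ∀ x ∈ X, ψ (x - p) = 0 := fun x hx => hψX (sub_mem_dir hx hp)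
  obtain ⟨e', he', hmin⟩ := exists_min_image (A.filter fun x => 0 < ψ (x - p))
    (fun x => (s - (α x + φ x)) / ψ (x - p)) ⟨e, mem_filter.2 ⟨he, hψe⟩⟩
  obtain ⟨he'A, he'ψ⟩ := mem_filter.1 he'
  -- The smallest tilt at which a point on the positive side of `ψ` meets the face; minimality keeps
  -- all other points below it.
  set τ := (s - (α e' + φ e')) / ψ (e' - p) with hτ
  have hτ0 : 0 ≤ τ := div_nonneg (sub_nonneg.2 (hs e' he'A)) he'ψ.le
  have hτe : τ * ψ (e' - p) = s - (α e' + φ e') := div_mul_cancel₀ _ he'ψ.ne'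
  have hval : ∀ x, α x + (φ + τ • ψ) x = α x + φ x + τ * ψ (x - p) + τ * ψ p := by
    intro x
    simp only [LinearMap.add_apply, LinearMap.smul_apply, smul_eq_mul, map_sub]
    ring
  have hmem : ∀ x ∈ insert e' X, x ∈ A.filter fun x => α x + (φ + τ • ψ) x = s + τ * ψ p := by
    intro x hx
    rcases mem_insert.1 hx with rfl | hx
    · refine mem_filter.2 ⟨he'A, ?_⟩
      rw [hval, hτe]; ring
    · refine mem_filter.2 ⟨(mem_filter.1 hx).1, ?_⟩
      rw [hval, hXψ x hx, (mem_filter.1 hx).2]; ring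
  refine ⟨φ + τ • ψ, s + τ * ψ p, fun x hx => ?_, ⟨p, hmem p (mem_insert_of_mem hp)⟩, ?_⟩
  · rw [hval]
    have h1 := hs x hx
    rcases le_or_gt (ψ (x - p)) 0 with h | h
    · have := mul_nonpos_of_nonneg_of_nonpos hτ0 h
      linarith
    · have := hmin x (mem_filter.2 ⟨hx, h⟩)
      rw [le_div_iff₀ h] at this
      linarith
  · refine lt_of_lt_of_le ?_ (rk_mono hmem)
    by_contra hc
    have h1 := dir_eq_of_rk_le (subset_insert e' X) (not_lt.1 hc)
    have h2 : e' - p ∈ dir X := by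
      rw [h1]; exact sub_mem_dir (mem_insert_self _ _) (mem_insert_of_mem hp)
    have h3 : ψ (e' - p) = 0 := hψX h2
    exact he'ψ.ne' h3

lemma exists_face_dir_eq {A : Finset E} (hA : A.Nonempty) (α : E → ℝ) :
    ∃ (φ : E →ₗ[ℝ] ℝ) (s : ℝ), (∀ x ∈ A, α x + φ x ≤ s) ∧
      (A.filter fun x => α x + φ x = s).Nonempty ∧
      dir (A.filter fun x => α x + φ x = s) = dir A := by
  have key : ∀ j : ℕ, j ≤ rk A → ∃ (φ : E →ₗ[ℝ] ℝ) (s : ℝ), (∀ x ∈ A, α x + φ x ≤ s) ∧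
      (A.filter fun x => α x + φ x = s).Nonempty ∧
      j ≤ rk (A.filter fun x => α x + φ x = s) := by
    intro j
    induction j with
    | zero =>
      intro _
      obtain ⟨x, hx, hmax⟩ := exists_max_image A α hA
      exact ⟨0, α x, by simpa using hmax, ⟨x, by simp [hx]⟩, Nat.zero_le _⟩
    | succ j ih =>
      intro hj
      obtain ⟨φ, s, hs, hne, hr⟩ := ih (by omega)
      rcases Nat.lt_or_ge (rk (A.filter fun x => α x + φ x = s)) (rk A) with h | h
      · obtain ⟨φ', s', hs', hne', hr'⟩ := exists_face_rk_lt α hs hne h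
        exact ⟨φ', s', hs', hne', by omega⟩
      · exact ⟨φ, s, hs, hne, by omega⟩
  obtain ⟨φ, s, hs, hne, hr⟩ := key _ le_rfl
  exact ⟨φ, s, hs, hne, dir_eq_of_rk_le (filter_subset _ _) hr⟩

/-- One `f`-maximal representative is taken in each coset of `V` met by `B`, except that of `p`.
Modulo `V`, their differences from `p` span `dir B`, which bounds their number from below. -/
lemma exists_coset_reps (V : Submodule ℝ E) (f : E → ℝ) {B : Finset E} {p : E} (hp : p ∈ B) :
    ∃ R ⊆ B, (∀ y ∈ R, y - p ∉ V ∧ ∀ y' ∈ B, y' - y ∈ V → f y' ≤ f y) ∧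
      (∀ y ∈ R, ∀ y' ∈ R, y - y' ∈ V → y = y') ∧
      finrank ℝ (V ⊔ dir B : Submodule ℝ E) ≤ finrank ℝ V + #R := by
  classical
  have hex : ∀ κ ∈ B.image V.mkQ, ∃ y ∈ B, V.mkQ y = κ ∧ ∀ y' ∈ B, V.mkQ y' = κ → f y' ≤ f y := by
    intro κ hκ
    obtain ⟨y, hy, hyκ⟩ := mem_image.1 hκ
    obtain ⟨y₁, hy₁, hmax⟩ := exists_max_image (B.filter fun y => V.mkQ y = κ) f
      ⟨y, mem_filter.2 ⟨hy, hyκ⟩⟩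
    exact ⟨y₁, (mem_filter.1 hy₁).1, (mem_filter.1 hy₁).2,
      fun y' hy' h => hmax y' (mem_filter.2 ⟨hy', h⟩)⟩
  choose! rep hrB hrκ hrmax using hex
  have hq : ∀ {x y : E}, x - y ∈ V ↔ V.mkQ x = V.mkQ y := fun {x y} => by
    rw [Submodule.mkQ_apply, Submodule.mkQ_apply, Submodule.Quotient.eq]
  set Q := (B.image V.mkQ).erase (V.mkQ p) with hQ
  refine ⟨Q.image rep, ?_, ?_, ?_, ?_⟩
  · intro y hy
    obtain ⟨κ, hκ, rfl⟩ := mem_image.1 hy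
    exact hrB κ (mem_of_mem_erase hκ)
  · intro y hy
    obtain ⟨κ, hκ, rfl⟩ := mem_image.1 hy
    have hκ' := mem_of_mem_erase hκ
    refine ⟨fun h => ne_of_mem_erase hκ ?_, fun y' hy' h => hrmax κ hκ' y' hy' ?_⟩
    · rw [← hq.1 h, hrκ κ hκ']
    · rw [hq.1 h, hrκ κ hκ']
  · intro y hy y' hy' h
    obtain ⟨κ, hκ, rfl⟩ := mem_image.1 hy
    obtain ⟨κ', hκ', rfl⟩ := mem_image.1 hy'
    rw [hq, hrκ κ (mem_of_mem_erase hκ), hrκ κ' (mem_of_mem_erase hκ')] at h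
    rw [h]
  · have hle : V ⊔ dir B ≤
        V ⊔ Submodule.span ℝ (((Q.image rep).image fun y => y - p : Finset E) : Set E) := by
      refine sup_le le_sup_left ((dir_le_iff hp).2 fun x hx => ?_)
      by_cases h : V.mkQ x = V.mkQ p
      · exact Submodule.mem_sup_left (hq.2 h)
      · have hκ : V.mkQ x ∈ B.image V.mkQ := mem_image_of_mem _ hx
        have e : x - p = (x - rep (V.mkQ x)) + (rep (V.mkQ x) - p) := by abel
        rw [e]
        refine Submodule.add_mem_sup (hq.2 (hrκ _ hκ).symm) (Submodule.subset_span (mem_coe.2 ?_))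
        exact mem_image_of_mem _ (mem_image_of_mem _ (mem_erase.2 ⟨h, hκ⟩))
    refine (Submodule.finrank_mono hle).trans
      ((Submodule.finrank_add_le_finrank_add_finrank _ _).trans (Nat.add_le_add_left ?_ _))
    exact (finrank_span_finset_le_card _).trans card_image_le

/-- The first-order condition tested on the uniform weights of a pair of faces. -/
lemma face_rate_le {A B X Y Z : Finset E} {α β : E → ℝ} {φ : E →ₗ[ℝ] ℝ} {s t lam l : ℝ} {p : E}
    (hrate : ∀ ρ σ L : E → ℝ, IsWt A ρ → IsWt B σ →
      (∀ x ∈ A, ∀ y ∈ B, val A B α β (x + y) = α x + β y → L (x + y) ≤ ρ x + σ y) →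
      ∑ z ∈ A + B, L z ≤ lam)
    (hs : ∀ x ∈ A, α x + φ x ≤ s) (hX : X = A.filter fun x => α x + φ x = s) (hXne : X.Nonempty)
    (hp : p ∈ B) (ht : ∀ y ∈ B, y - p ∈ dir A → β y + φ y ≤ t)
    (hYm : ∀ y, y ∈ Y ↔ y ∈ B ∧ y - p ∈ dir A ∧ β y + φ y = t) (hYne : Y.Nonempty)
    (hl : 0 ≤ l) (hZ : Z ⊆ A + B)
    (hZ2 : ∀ z ∈ Z, z ∉ X + Y ∧ ∀ x ∈ A, ∀ y ∈ B, x + y = z → y - p ∈ dir A ∧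
      (val A B α β z = α x + β y → l ≤ unif X x + unif Y y)) :
    #(X + Y) * ((#X : ℝ)⁻¹ + (#Y : ℝ)⁻¹) + #Z * l + finrank ℝ (dir A ⊔ dir B : Submodule ℝ E) ≤
      lam + rk A := by
  obtain ⟨R, hRB, hR1, hR2, hR3⟩ := exists_coset_reps (dir A) (fun y => β y + φ y) hp
  have hXA : X ⊆ A := hX ▸ filter_subset _ _
  have hYB : Y ⊆ B := fun y hy => ((hYm y).1 hy).1
  have hXm : ∀ {x}, x ∈ X ↔ x ∈ A ∧ α x + φ x = s := by simp [hX]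
  replace hYm : ∀ {y}, y ∈ Y ↔ y ∈ B ∧ y - p ∈ dir A ∧ β y + φ y = t := fun {y} => hYm y
  have hcoset : ∀ {x y x' y' : E}, x ∈ A → x' ∈ A → x + y = x' + y' → y - y' ∈ dir A := by
    intro x y x' y' hx hx' h
    have e : y - y' = x' - x := by rw [sub_eq_sub_iff_add_eq_add, add_comm, h]
    rw [e]; exact sub_mem_dir hx' hx
  -- The test function has three disjoint supports: the face sums, an optional extra layer `Z`, and
  -- one copy of `X` for each further coset, of total mass 1 each.
  set L : E → ℝ := fun z => if z ∈ X + Y then (#X : ℝ)⁻¹ + (#Y : ℝ)⁻¹ else if z ∈ Z then l else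
    if z ∈ X + R then (#X : ℝ)⁻¹ else 0 with hL
  have hL0 : ∀ z, 0 ≤ L z := by
    intro z
    simp only [hL]
    split_ifs <;> positivity
  have htight : ∀ x ∈ A, ∀ y ∈ B, val A B α β (x + y) = α x + β y →
      L (x + y) ≤ unif X x + unif Y y := by
    intro x hx y hy hv
    simp only [hL]
    split_ifs with h1 h2 h3
    · obtain ⟨x₁, hx₁, y₁, hy₁, he⟩ := mem_add.1 h1
      have h4 := le_val (α := α) (β := β) (hXA hx₁) (hYB hy₁) he
      rw [hv] at h4
      have h5 : y - p ∈ dir A := by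
        have := (dir A).add_mem (hcoset hx (hXA hx₁) he.symm) (hYm.1 hy₁).2.1
        simpa using this
      -- A tight pair is at least as high for the tilted weights as any other pair with the same
      -- sum, so if it shares a sum with top points, both its entries are on top.
      have h6 := hs x hx
      have h7 := ht y hy h5
      have h8 := (hXm.1 hx₁).2
      have h9 := (hYm.1 hy₁).2.2
      have h10 : φ x₁ + φ y₁ = φ x + φ y := by rw [← map_add, ← map_add, he]
      rw [unif_of_mem (hXm.2 ⟨hx, by linarith⟩), unif_of_mem (hYm.2 ⟨hy, h5, by linarith⟩)]
    · exact ((hZ2 _ h2).2 x hx y hy rfl).2 hv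
    · obtain ⟨x₁, hx₁, y₁, hy₁, he⟩ := mem_add.1 h3
      have h4 := le_val (α := α) (β := β) (hXA hx₁) (hRB hy₁) he
      rw [hv] at h4
      have h6 := hs x hx
      have h7 := (hR1 y₁ hy₁).2 y hy (hcoset hx (hXA hx₁) he.symm)
      have h8 := (hXm.1 hx₁).2
      have h10 : φ x₁ + φ y₁ = φ x + φ y := by rw [← map_add, ← map_add, he]
      rw [unif_of_mem (hXm.2 ⟨hx, by linarith⟩)]
      exact le_add_of_nonneg_right (unif_nonneg _ _)
    · exact add_nonneg (unif_nonneg _ _) (unif_nonneg _ _)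
  have hsum := hrate _ _ L (isWt_unif hXne hXA) (isWt_unif hYne hYB) htight
  have hd1 : Disjoint (X + Y) Z := disjoint_right.2 fun z hz => (hZ2 z hz).1
  have hd2 : Disjoint (X + Y ∪ Z) (X + R) := by
    rw [disjoint_right]
    intro z hz hz'
    obtain ⟨x, hx, y, hy, rfl⟩ := mem_add.1 hz
    rcases mem_union.1 hz' with h | h
    · obtain ⟨x₁, hx₁, y₁, hy₁, he⟩ := mem_add.1 h
      apply (hR1 y hy).1
      have := (dir A).add_mem (hcoset (hXA hx) (hXA hx₁) he.symm) (hYm.1 hy₁).2.1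
      simpa using this
    · exact (hR1 y hy).1 ((hZ2 _ h).2 x (hXA hx) y (hRB hy) rfl).1
  have hcard : #(X + R) = #X * #R := by
    rw [card_add_iff]
    rintro ⟨x, y⟩ hxy ⟨x', y'⟩ hxy' he
    obtain ⟨hx, hy⟩ : x ∈ X ∧ y ∈ R := by simpa using hxy
    obtain ⟨hx', hy'⟩ : x' ∈ X ∧ y' ∈ R := by simpa using hxy'
    have he : x + y = x' + y' := he
    have h := hR2 y hy y' hy' (hcoset (hXA hx) (hXA hx') he)
    subst h
    rw [add_right_cancel he]
  have hsub : X + Y ∪ Z ∪ (X + R) ⊆ A + B :=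
    union_subset (union_subset (add_subset_add hXA hYB) hZ) (add_subset_add hXA hRB)
  have h1 := (sum_le_sum_of_subset_of_nonneg hsub fun z _ _ => hL0 z).trans hsum
  rw [sum_union hd2, sum_union hd1] at h1
  have e1 : ∑ z ∈ X + Y, L z = #(X + Y) * ((#X : ℝ)⁻¹ + (#Y : ℝ)⁻¹) := by
    rw [sum_congr rfl fun z hz => (if_pos hz : L z = _), sum_const, nsmul_eq_mul]
  have e2 : ∑ z ∈ Z, L z = #Z * l := by
    rw [sum_congr rfl fun z hz => ?_, sum_const, nsmul_eq_mul]
    simp only [hL]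
    rw [if_neg (hZ2 z hz).1, if_pos hz]
  have e3 : ∑ z ∈ X + R, L z = #R := by
    have h0 : (#X : ℝ) ≠ 0 := by exact_mod_cast hXne.card_pos.ne'
    rw [sum_congr rfl fun z hz => ?_, sum_const, nsmul_eq_mul, hcard, Nat.cast_mul,
      mul_right_comm, mul_inv_cancel₀ h0, one_mul]
    have h := disjoint_right.1 hd2 hz
    rw [mem_union, not_or] at h
    simp only [hL]
    rw [if_neg h.1, if_neg h.2, if_pos hz]
  rw [e1, e2, e3] at h1
  have h3 : (finrank ℝ (dir A ⊔ dir B : Submodule ℝ E) : ℝ) ≤ rk A + #R := by exact_mod_cast hR3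
  linarith

end

/-! ### The lower bound at a positive minimizer -/

section

variable {E : Type*} [AddCommGroup E] [Module ℝ E] [FiniteDimensional ℝ E] [DecidableEq E]

lemma mul_inv_add_inv (N : ℝ) {x y : ℝ} (hx : 0 < x) (hy : 0 < y) :
    N * (x⁻¹ + y⁻¹) = N * (x + y) / (x * y) := by
  field_simp
  ring

/-- Serves two independent faces of equal size `t`, where the face sums alone give exactly `t + 1`
in the worst case. `N` counts the face sums and `N'` the sums after one face gains a point. -/
lemma half_sum_ge {t N N' : ℝ} (ht : 2 ≤ t) (hN : t * (t + 1) ≤ 2 * N)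
    (hN' : (t + 1) * ((t + 1) * t) ≤ N' * (t + 1 + t)) :
    t + 1 + 1 / 6 ≤ N * t⁻¹ + N' * t⁻¹ := by
  have h0 : 0 < t := by linarith
  rw [← add_mul, ← div_eq_mul_inv, le_div_iff₀ h0]
  have h1 : (t + 1 + 1 / 6) * t - N ≤ N' := by
    have h2 : 0 < t + 1 + t := by linarith
    refine le_of_mul_le_mul_right ?_ h2
    nlinarith
  linarith

/-- If the top faces `X`, `Y` are affinely independent but `X ≠ A`, then one further layer of sums
improves the bound. -/
lemma extra_layer_bound {A B X Y : Finset E} {α β : E → ℝ} {φ : E →ₗ[ℝ] ℝ} {s t lam m : ℝ} {p : E}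
    (hs : ∀ x ∈ A, α x + φ x ≤ s) (hXm : ∀ x, x ∈ X ↔ x ∈ A ∧ α x + φ x = s)
    (ht : ∀ y ∈ B, y - p ∈ dir A → β y + φ y ≤ t)
    (hYm : ∀ y, y ∈ Y ↔ y ∈ B ∧ y - p ∈ dir A ∧ β y + φ y = t) (hYne : Y.Nonempty)
    (hrate : ∀ (Z : Finset E) (l : ℝ), 0 ≤ l → Z ⊆ A + B →
      (∀ z ∈ Z, z ∉ X + Y ∧ ∀ x ∈ A, ∀ y ∈ B, x + y = z → y - p ∈ dir A ∧
        (val A B α β z = α x + β y → l ≤ unif X x + unif Y y)) →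
      #(X + Y) * ((#X : ℝ)⁻¹ + (#Y : ℝ)⁻¹) + #Z * l + m ≤ lam + rk A)
    (hdir : dir X = dir A) (hX : #X = rk X + 1) (hY : #Y = rk Y + 1) (hA : rk A + 2 ≤ #A) :
    m + 2 + 1 / 6 ≤ lam := by
  classical
  have hXA : X ⊆ A := fun x hx => ((hXm x).1 hx).1
  have hYB : Y ⊆ B := fun y hy => ((hYm y).1 hy).1
  have hrk : rk X = rk A := by unfold rk; rw [hdir]
  have hk : 1 ≤ rk A := rk_pos (by omega)
  have hcoset : ∀ {x y x' y' : E}, x ∈ A → x' ∈ A → x + y = x' + y' → y - y' ∈ dir A := by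
    intro x y x' y' hx hx' h
    have e : y - y' = x' - x := by rw [sub_eq_sub_iff_add_eq_add, add_comm, h]
    rw [e]; exact sub_mem_dir hx' hx
  have hrep : ∀ x₁ ∈ A, ∀ y₁ ∈ B, y₁ - p ∈ dir A → ∀ x' ∈ A, ∀ y' ∈ B, x' + y' = x₁ + y₁ →
      y' - p ∈ dir A ∧ (val A B α β (x₁ + y₁) = α x' + β y' →
        (α x₁ + φ x₁) + (β y₁ + φ y₁) ≤ (α x' + φ x') + (β y' + φ y')) := by
    intro x₁ hx₁ y₁ hy₁ hp x' hx' y' hy' he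
    refine ⟨?_, fun hv => ?_⟩
    · have := (dir A).add_mem (hcoset hx' hx₁ he) hp
      simpa using this
    · have h1 := le_val (α := α) (β := β) hx₁ hy₁ rfl
      rw [hv] at h1
      have h2 : φ x' + φ y' = φ x₁ + φ y₁ := by rw [← map_add, ← map_add, he]
      linarith
  have hYdir : ∀ y ∈ Y, ∀ y' ∈ B, y' - p ∈ dir A → y' - y ∈ dir A := by
    intro y hy y' _ hp
    have := (dir A).sub_mem hp ((hYm y).1 hy).2.1
    simpa using this
  have hYle : dir Y ≤ dir A := by
    refine dir_le_of_forall fun y hy y' hy' => ?_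
    exact hYdir y' hy' y (hYB hy) ((hYm y).1 hy).2.1
  have hYk : rk Y ≤ rk A := Submodule.finrank_mono hYle
  have hYX : #Y ≤ #X := by omega
  have hy0 := hYne.card_pos
  have hxR : (#X : ℝ) = rk A + 1 := by rw [hX, hrk]; push_cast; ring
  have hx2 : (2 : ℝ) ≤ #X := by exact_mod_cast (by omega : 2 ≤ #X)
  have hxpos : (0 : ℝ) < #X := by linarith
  have hypos : (0 : ℝ) < #Y := by exact_mod_cast hy0
  -- the second best level
  obtain ⟨x₀, hx₀, hx₀max⟩ := exists_max_image (A \ X) (fun x => α x + φ x) (by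
    rw [sdiff_nonempty]
    intro h
    have := card_le_card h
    omega)
  obtain ⟨hx₀A, hx₀X⟩ := mem_sdiff.1 hx₀
  have hltX : ∀ x ∈ A, x ∉ X → α x + φ x < s := fun x hx hxX =>
    lt_of_le_of_ne (hs x hx) fun h => hxX ((hXm x).2 ⟨hx, h⟩)
  have hltY : ∀ y ∈ B, y - p ∈ dir A → y ∉ Y → β y + φ y < t := fun y hy hp hyY =>
    lt_of_le_of_ne (ht y hy hp) fun h => hyY ((hYm y).2 ⟨hy, hp, h⟩)
  have hinvxy : (#X : ℝ)⁻¹ ≤ (#Y : ℝ)⁻¹ :=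
    inv_anti₀ hypos (by exact_mod_cast hYX)
  -- the two possible layers
  have hlayer : (∃ x₀ ∈ A, x₀ ∉ X ∧ #(X + Y) * (#X : ℝ)⁻¹ + #(insert x₀ X + Y) * (#Y : ℝ)⁻¹ + m ≤
      lam + rk A) ∨ (∃ y₀ ∈ B, y₀ - p ∈ dir A ∧ y₀ ∉ Y ∧
        #(X + Y) * (#Y : ℝ)⁻¹ + #(X + insert y₀ Y) * (#X : ℝ)⁻¹ + m ≤ lam + rk A) := by
    -- Compare how far points outside the faces lie below the top. If some point of `B` loses no
    -- more than `x₀`, a layer is added through `Y`, otherwise through `X`.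
    by_cases hII : ∃ y₀ ∈ B, y₀ - p ∈ dir A ∧ y₀ ∉ Y ∧ t - (β y₀ + φ y₀) ≤ s - (α x₀ + φ x₀)
    · right
      obtain ⟨y₁, hy₁B, hy₁p, hy₁Y, hy₁⟩ := hII
      obtain ⟨y₀, hy₀, hy₀max⟩ := exists_max_image (B.filter fun y => y - p ∈ dir A ∧ y ∉ Y)
        (fun y => β y + φ y) ⟨y₁, mem_filter.2 ⟨hy₁B, hy₁p, hy₁Y⟩⟩
      obtain ⟨hy₀B, hy₀p, hy₀Y⟩ := mem_filter.1 hy₀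
      have hy₀₁ := hy₀max y₁ (mem_filter.2 ⟨hy₁B, hy₁p, hy₁Y⟩)
      refine ⟨y₀, hy₀B, hy₀p, hy₀Y, ?_⟩
      have h := hrate ((X + insert y₀ Y) \ (X + Y)) (#X : ℝ)⁻¹ (by positivity)
        (sdiff_subset.trans (add_subset_add hXA (insert_subset hy₀B hYB))) (by
          intro z hz
          obtain ⟨hz1, hz2⟩ := mem_sdiff.1 hz
          refine ⟨hz2, ?_⟩
          obtain ⟨x₂, hx₂, y₂, hy₂, rfl⟩ := mem_add.1 hz1
          rcases mem_insert.1 hy₂ with rfl | hy₂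
          · intro x' hx' y' hy' he
            obtain ⟨h1, h2⟩ := hrep x₂ (hXA hx₂) y₂ hy₀B hy₀p x' hx' y' hy' he
            refine ⟨h1, fun hv => ?_⟩
            have h3 := h2 hv
            rw [((hXm x₂).1 hx₂).2] at h3
            by_cases hx'X : x' ∈ X
            · rw [unif_of_mem hx'X]
              exact le_add_of_nonneg_right (unif_nonneg _ _)
            by_cases hy'Y : y' ∈ Y
            · rw [unif_of_mem hy'Y]
              exact hinvxy.trans (le_add_of_nonneg_left (unif_nonneg _ _))
            -- A pair missing both faces is strictly below `x₂ + y₀`: its second entry is no higher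
            -- than `y₀`, and its first is below the top of `A`.
            exfalso
            have h4 := hx₀max x' (mem_sdiff.2 ⟨hx', hx'X⟩)
            have h5 := hy₀max y' (mem_filter.2 ⟨hy', h1, hy'Y⟩)
            have h6 := hltX x' hx' hx'X
            linarith
          · exact absurd (add_mem_add hx₂ hy₂) hz2)
      have hc := card_sdiff_add_card_eq_card
        (add_subset_add_left (s := X) (subset_insert y₀ Y))
      have hc' : (#((X + insert y₀ Y) \ (X + Y)) : ℝ) = #(X + insert y₀ Y) - #(X + Y) := by
        rw [← hc]; push_cast; ring
      rw [hc'] at h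
      linarith
    · left
      push Not at hII
      refine ⟨x₀, hx₀A, hx₀X, ?_⟩
      have h := hrate ((insert x₀ X + Y) \ (X + Y)) (#Y : ℝ)⁻¹ (by positivity)
        (sdiff_subset.trans (add_subset_add (insert_subset hx₀A hXA) hYB)) (by
          intro z hz
          obtain ⟨hz1, hz2⟩ := mem_sdiff.1 hz
          refine ⟨hz2, ?_⟩
          obtain ⟨x₂, hx₂, y₂, hy₂, rfl⟩ := mem_add.1 hz1
          rcases mem_insert.1 hx₂ with rfl | hx₂
          · intro x' hx' y' hy' he
            obtain ⟨h1, h2⟩ := hrep x₂ hx₀A y₂ (hYB hy₂) ((hYm y₂).1 hy₂).2.1 x' hx' y' hy' he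
            refine ⟨h1, fun hv => ?_⟩
            have h3 := h2 hv
            rw [((hYm y₂).1 hy₂).2.2] at h3
            by_cases hy'Y : y' ∈ Y
            · rw [unif_of_mem hy'Y]
              exact le_add_of_nonneg_left (unif_nonneg _ _)
            -- Every point of `B` outside `Y` in this coset loses strictly more than `x₀`, so such a
            -- pair cannot compete with `x₀ + y₂`.
            exfalso
            have h4 := hs x' hx'
            have h5 := hII y' hy' h1 hy'Y
            linarith
          · exact absurd (add_mem_add hx₂ hy₂) hz2)
      have hc := card_sdiff_add_card_eq_card
        (add_subset_add_right (subset_insert x₀ X) : X + Y ⊆ insert x₀ X + Y)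
      have hc' : (#((insert x₀ X + Y) \ (X + Y)) : ℝ) = #(insert x₀ X + Y) - #(X + Y) := by
        rw [← hc]; push_cast; ring
      rw [hc'] at h
      linarith
  have hNind : 2 * (#X : ℝ) * #Y - #Y * (#Y - 1) ≤ 2 * #(X + Y) := by
    exact_mod_cast card_add_ge_of_indep hX Y
  have hNx : (#X : ℝ) ≤ #(X + Y) := by exact_mod_cast card_le_card_add_right hYne
  suffices hgoal : (#X : ℝ) + 1 + 1 / 6 + m ≤ lam + rk A by linarith
  rcases Nat.lt_or_ge (#Y) (#X) with hlt | hge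
  · rcases Nat.lt_or_ge 1 (#Y) with h1 | h1
    · -- the faces alone suffice
      have h := hrate ∅ 0 le_rfl (empty_subset _) (by simp)
      have hy2 : (2 : ℝ) ≤ #Y := by exact_mod_cast h1
      have hyx : (#Y : ℝ) + 1 ≤ #X := by exact_mod_cast hlt
      -- The lower bound on `N` gives a surplus of (y - 1)(x - y)/(2x) over x + 1. For 2 ≤ y < x it
      -- is least at y = 2, x = 3, where it equals 1/6.
      have : (#X : ℝ) + 1 + 1 / 6 ≤ #(X + Y) * ((#X : ℝ)⁻¹ + (#Y : ℝ)⁻¹) := by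
        generalize (#(X + Y) : ℝ) = N at *
        generalize (#X : ℝ) = x at *
        generalize (#Y : ℝ) = y at *
        rw [mul_inv_add_inv N hxpos hypos, le_div_iff₀ (by positivity)]
        have h2 := mul_le_mul_of_nonneg_right hNind (by linarith : 0 ≤ x + y)
        obtain ⟨u, rfl⟩ : ∃ u, y = u + 2 := ⟨y - 2, by ring⟩
        obtain ⟨v, rfl⟩ : ∃ v, x = u + 3 + v := ⟨x - u - 3, by ring⟩
        have hu : 0 ≤ u := by linarith
        have hv : 0 ≤ v := by linarith
        nlinarith [mul_nonneg hu hv, mul_nonneg (mul_nonneg hu hv) hu,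
          mul_nonneg (mul_nonneg hu hu) hu, mul_nonneg hu hu]
      simp only [card_empty, Nat.cast_zero, zero_mul, add_zero] at h
      linarith
    · have hy1 : #Y = 1 := le_antisymm h1 hy0
      rcases hlayer with ⟨x₁, hx₁, hx₁X, h⟩ | ⟨y₁, hy₁, hy₁p, hy₁Y, h⟩
      · have h2 : (#X : ℝ) + 1 ≤ #(insert x₁ X + Y) := by
          have := card_le_card_add_right (s := insert x₁ X) hYne
          rw [card_insert_of_notMem hx₁X] at this
          exact_mod_cast this
        have h3 : 1 ≤ #(X + Y) * (#X : ℝ)⁻¹ := by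
          rw [← div_eq_mul_inv, le_div_iff₀ hxpos]; linarith
        rw [hy1] at h
        simp only [Nat.cast_one, inv_one, mul_one] at h
        linarith
      · have h2 := card_add_ge_of_indep hX (insert y₁ Y)
        rw [card_insert_of_notMem hy₁Y, hy1] at h2
        have h2' : 2 * (#X : ℝ) * 2 - 2 * (2 - 1) ≤ 2 * #(X + insert y₁ Y) := by exact_mod_cast h2
        have h3 : 1 + 1 / 2 ≤ #(X + insert y₁ Y) * (#X : ℝ)⁻¹ := by
          rw [← div_eq_mul_inv, le_div_iff₀ hxpos]; linarith
        rw [hy1] at h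
        simp only [Nat.cast_one, inv_one, mul_one] at h
        linarith
  · have hyx : #Y = #X := le_antisymm hYX hge
    have hXne : X.Nonempty := card_pos.1 (by omega)
    rw [hyx] at hNind
    have hN2 : (#X : ℝ) * (#X + 1) ≤ 2 * #(X + Y) := by linarith
    -- With one more point at unchanged rank the enlarged face is dependent, but the main term `rk +
    -- 2 = #X + 1` of the uniform bound already suffices here.
    have hflat : ∀ {X' Y' : Finset E}, rk X' = rk A → #X' = #X + 1 → #Y' = #X →
        ((#X : ℝ) + 1) * ((#X + 1) * #X) ≤ #(X' + Y') * (#X + 1 + #X) := by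
      intro X' Y' h1 h2 h3
      have h4 := flat_bound (X := X') (Y := Y') (card_pos.1 (by omega))
        (card_pos.1 (by omega)) (by omega)
      rw [h1, h2, h3] at h4
      push_cast at h4
      refine le_trans (mul_le_mul_of_nonneg_right ?_ (by positivity)) h4
      rw [hxR]
      split_ifs <;> linarith
    rcases hlayer with ⟨x₁, hx₁, hx₁X, h⟩ | ⟨y₁, hy₁, hy₁p, hy₁Y, h⟩
    · have hr : rk (insert x₁ X) = rk A :=
        le_antisymm (rk_mono (insert_subset hx₁ hXA)) (hrk ▸ rk_mono (subset_insert _ _))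
      have := half_sum_ge hx2 hN2 (hflat hr (card_insert_of_notMem hx₁X) hyx)
      rw [hyx] at h
      linarith
    · have hle : dir (insert y₁ Y) ≤ dir A := by
        obtain ⟨y₂, hy₂⟩ := hYne
        refine (dir_le_iff (mem_insert_of_mem hy₂)).2 fun y hy => ?_
        rcases mem_insert.1 hy with rfl | hy
        · exact hYdir y₂ hy₂ y hy₁ hy₁p
        · exact hYle (sub_mem_dir hy hy₂)
      have hr : rk (insert y₁ Y) = rk A := by
        refine le_antisymm (Submodule.finrank_mono hle) ?_
        have := rk_mono (subset_insert y₁ Y)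
        omega
      have hc := card_insert_of_notMem hy₁Y
      rw [hyx] at hc
      have := hflat hr hc rfl
      rw [add_comm (insert y₁ Y) X] at this
      have := half_sum_ge hx2 hN2 this
      rw [hyx] at h
      linarith

/-- The hypothesis `hdep` makes `A` dependent whenever the pair is. The exceptional alternative
arises only when the faces are all of `A` and `B` and `B` is larger; exchanging the two sets then
removes it. -/
lemma role_bound {A B : Finset E} {α β : E → ℝ} {lam : ℝ} (hA : A.Nonempty) (hB : B.Nonempty)
    (hrate : ∀ ρ σ L : E → ℝ, IsWt A ρ → IsWt B σ →
      (∀ x ∈ A, ∀ y ∈ B, val A B α β (x + y) = α x + β y → L (x + y) ≤ ρ x + σ y) →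
      ∑ z ∈ A + B, L z ≤ lam)
    (hIH : ∀ X ⊆ A, ∀ Y ⊆ B, X.Nonempty → Y.Nonempty → #X + #Y < #A + #B →
      (finrank ℝ (dir X ⊔ dir Y : Submodule ℝ E) : ℝ) + 2 +
        (if rk X + 2 ≤ #X ∨ rk Y + 2 ≤ #Y then 1 / 6 else 0) ≤
        #(X + Y) * ((#X : ℝ)⁻¹ + (#Y : ℝ)⁻¹))
    (hdep : rk A + 2 ≤ #A ∨ ¬ rk B + 2 ≤ #B) :
    (finrank ℝ (dir A ⊔ dir B : Submodule ℝ E) : ℝ) + 2 +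
        (if rk A + 2 ≤ #A ∨ rk B + 2 ≤ #B then 1 / 6 else 0) ≤ lam ∨
      (dir B ≤ dir A ∧ #A < #B) := by
  classical
  obtain ⟨φ, s, hs, hXne, hdir⟩ := exists_face_dir_eq hA α
  set X := A.filter fun x => α x + φ x = s with hX
  obtain ⟨p, hp⟩ := hB
  obtain ⟨y₀, hy₀, hmax⟩ := exists_max_image (B.filter fun y => y - p ∈ dir A)
    (fun y => β y + φ y) ⟨p, mem_filter.2 ⟨hp, by simp⟩⟩
  obtain ⟨hy₀B, hy₀p⟩ := mem_filter.1 hy₀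
  set t := β y₀ + φ y₀ with ht0
  have ht : ∀ y ∈ B, y - p ∈ dir A → β y + φ y ≤ t := fun y hy h =>
    hmax y (mem_filter.2 ⟨hy, h⟩)
  set Y := B.filter fun y => y - p ∈ dir A ∧ β y + φ y = t with hY
  have hYm : ∀ y, y ∈ Y ↔ y ∈ B ∧ y - p ∈ dir A ∧ β y + φ y = t := by simp [hY]
  have hYne : Y.Nonempty := ⟨y₀, (hYm y₀).2 ⟨hy₀B, hy₀p, rfl⟩⟩
  have hXA : X ⊆ A := filter_subset _ _
  have hYB : Y ⊆ B := filter_subset _ _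
  have hrk : rk X = rk A := by unfold rk; rw [hdir]
  have hface := fun (Z : Finset E) (l : ℝ) (hl : 0 ≤ l) (hZ : Z ⊆ A + B)
    (hZ2 : ∀ z ∈ Z, z ∉ X + Y ∧ ∀ x ∈ A, ∀ y ∈ B, x + y = z → y - p ∈ dir A ∧
      (val A B α β z = α x + β y → l ≤ unif X x + unif Y y)) =>
    face_rate_le hrate hs hX hXne hp ht hYm hYne hl hZ hZ2
  have hbase := hface ∅ 0 le_rfl (empty_subset _) (by simp)
  simp only [card_empty, Nat.cast_zero, zero_mul, add_zero] at hbase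
  by_cases hwhole : X = A ∧ Y = B
  · obtain ⟨hXA', hYB'⟩ := hwhole
    have hle : dir B ≤ dir A := by
      refine (dir_le_iff hp).2 fun y hy => ?_
      rw [← hYB'] at hy
      exact ((hYm y).1 hy).2.1
    rcases Nat.lt_or_ge (#A) (#B) with h | h
    · exact Or.inr ⟨hle, h⟩
    · left
      rw [hXA', hYB'] at hbase
      have hfl := flat_bound hA ⟨p, hp⟩ h
      have ha : (0 : ℝ) < #A := by exact_mod_cast hA.card_pos
      have hb : (0 : ℝ) < #B := by exact_mod_cast card_pos.2 ⟨p, hp⟩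
      rw [← le_div_iff₀ (mul_pos ha hb), ← mul_inv_add_inv _ ha hb] at hfl
      have hcond : (rk A + 2 ≤ #A ∨ rk B + 2 ≤ #B) ↔ rk A + 2 ≤ #A := by tauto
      simp only [hcond]
      linarith
  left
  have hlt : #X + #Y < #A + #B := by
    have h1 := card_le_card hXA
    have h2 := card_le_card hYB
    by_contra hc
    exact hwhole ⟨eq_of_subset_of_card_le hXA (by omega), eq_of_subset_of_card_le hYB (by omega)⟩
  have hih := hIH X hXA Y hYB hXne hYne hlt
  have hk : (rk A : ℝ) ≤ finrank ℝ (dir X ⊔ dir Y : Submodule ℝ E) := by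
    rw [hdir]
    exact_mod_cast Submodule.finrank_mono le_sup_left
  by_cases hd : rk X + 2 ≤ #X ∨ rk Y + 2 ≤ #Y
  · rw [if_pos hd] at hih
    split_ifs <;> linarith
  · rw [if_neg hd] at hih
    by_cases hdA : rk A + 2 ≤ #A
    · rw [if_pos (Or.inl hdA)]
      have h1 := rk_add_one_le_card hXne
      have h2 := rk_add_one_le_card hYne
      rw [not_or] at hd
      exact extra_layer_bound hs (by simp [hX]) ht hYm hYne hface hdir (by omega) (by omega) hdA
    · rw [if_neg (by tauto)]
      linarith

end

/-! ### Neighbours in `B` under differences of `A` -/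

section

variable {E : Type*} [AddCommGroup E]

/-- The points of `B` which differ from `y` by a difference of two points of `A`. -/
def nbr (A B : Finset E) (y : E) : Finset E :=
  open Classical in B.filter fun y' => ∃ u ∈ A, ∃ u' ∈ A, y' - y = u - u'

lemma mem_nbr {A B : Finset E} {y y' : E} :
    y' ∈ nbr A B y ↔ y' ∈ B ∧ ∃ u ∈ A, ∃ u' ∈ A, y' - y = u - u' := by
  simp [nbr]

lemma nbr_subset (A B : Finset E) (y : E) : nbr A B y ⊆ B :=
  fun _ h => (mem_nbr.1 h).1

lemma self_mem_nbr {A B : Finset E} {y : E} (hA : A.Nonempty) (hy : y ∈ B) : y ∈ nbr A B y := by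
  obtain ⟨u, hu⟩ := hA
  exact mem_nbr.2 ⟨hy, u, hu, u, hu, by simp⟩

variable [Module ℝ E]

lemma dir_nbr_le {A B : Finset E} {y : E} (hA : A.Nonempty) (hy : y ∈ B) :
    dir (nbr A B y) ≤ dir A ⊓ dir B := by
  refine (dir_le_iff (self_mem_nbr hA hy)).2 fun y' hy' => ?_
  obtain ⟨hy'B, u, hu, u', hu', he⟩ := mem_nbr.1 hy'
  refine ⟨?_, sub_mem_dir hy'B hy⟩
  rw [he]
  exact sub_mem_dir hu hu'

variable [FiniteDimensional ℝ E] [DecidableEq E]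

/-! ### Affinely independent pairs -/

lemma rk_union_le (T S : Finset E) : rk (T ∪ S) ≤ rk T + #S := by
  induction S using Finset.induction_on with
  | empty => simp
  | insert x S hx ih =>
    rw [union_insert, card_insert_of_notMem hx]
    have := rk_insert_le (T ∪ S) x
    omega

lemma card_eq_of_subset_of_indep {A T : Finset E} (hA : #A = rk A + 1) (hT : T ⊆ A)
    (hne : T.Nonempty) : #T = rk T + 1 := by
  have h1 := rk_union_le T (A \ T)
  rw [union_sdiff_of_subset hT] at h1
  have h2 := card_sdiff_add_card_eq_card hT
  have h3 := rk_add_one_le_card hne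
  omega

lemma indep_sum₂ {A : Finset E} (hA : #A = rk A + 1) {a b a' b' : E} (ha : a ∈ A) (hb : b ∈ A)
    (ha' : a' ∈ A) (hb' : b' ∈ A) (h : a + b = a' + b') :
    (a = a' ∧ b = b') ∨ (a = b' ∧ b = a') := by
  by_cases h1 : a = b'
  · subst h1
    right
    refine ⟨rfl, ?_⟩
    rw [add_comm a' a] at h
    exact add_left_cancel h
  · left
    have h2 : a = a' := sub_eq_sub_of_indep hA ha hb' ha' hb h1 (by
      rw [sub_eq_sub_iff_add_eq_add, h])
    subst h2
    exact ⟨rfl, add_left_cancel h⟩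

/-- The barycentric coordinate of `a` is at least 1 on the left side and vanishes on the right
unless `a` occurs there. -/
lemma indep_sum₃_mem {A : Finset E} (hA : #A = rk A + 1) {a b c a' b' c' : E} (ha : a ∈ A)
    (hb : b ∈ A) (hc : c ∈ A) (ha' : a' ∈ A) (hb' : b' ∈ A) (hc' : c' ∈ A)
    (h : a + b + c = a' + b' + c') : a = a' ∨ a = b' ∨ a = c' := by
  obtain ⟨g, k, hg⟩ := exists_coord hA ha
  have h1 : g a + g b + g c = g a' + g b' + g c' := by simp only [← map_add, h]
  have e1 := hg a ha
  have e2 := hg b hb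
  have e3 := hg c hc
  have e4 := hg a' ha'
  have e5 := hg b' hb'
  have e6 := hg c' hc'
  rw [if_pos rfl] at e1
  by_contra! hne
  rw [if_neg hne.1.symm] at e4
  rw [if_neg hne.2.1.symm] at e5
  rw [if_neg hne.2.2.symm] at e6
  split_ifs at e2 e3 <;> linarith

lemma indep_sum₃ {A : Finset E} (hA : #A = rk A + 1) {a b c a' b' c' : E} (ha : a ∈ A)
    (hb : b ∈ A) (hc : c ∈ A) (ha' : a' ∈ A) (hb' : b' ∈ A) (hc' : c' ∈ A)
    (h : a + b + c = a' + b' + c') :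
    (a = a' ∧ ((b = b' ∧ c = c') ∨ (b = c' ∧ c = b'))) ∨
    (a = b' ∧ ((b = a' ∧ c = c') ∨ (b = c' ∧ c = a'))) ∨
    (a = c' ∧ ((b = a' ∧ c = b') ∨ (b = b' ∧ c = a'))) := by
  rcases indep_sum₃_mem hA ha hb hc ha' hb' hc' h with rfl | rfl | rfl
  · refine Or.inl ⟨rfl, indep_sum₂ hA hb hc hb' hc' ?_⟩
    rw [add_assoc, add_assoc] at h
    exact add_left_cancel h
  · refine Or.inr (Or.inl ⟨rfl, indep_sum₂ hA hb hc ha' hc' ?_⟩)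
    rw [add_comm a', add_assoc, add_assoc] at h
    exact add_left_cancel h
  · refine Or.inr (Or.inr ⟨rfl, indep_sum₂ hA hb hc ha' hb' ?_⟩)
    rw [add_comm (a' + b'), add_assoc] at h
    exact add_left_cancel h

lemma card_nbr_le {A B : Finset E} {y : E} (hA : A.Nonempty) (hB : #B = rk B + 1) (hy : y ∈ B) :
    #(nbr A B y) ≤ finrank ℝ (dir A ⊓ dir B : Submodule ℝ E) + 1 := by
  rw [card_eq_of_subset_of_indep hB (nbr_subset A B y) ⟨y, self_mem_nbr hA hy⟩]
  exact Nat.add_le_add_right (Submodule.finrank_mono (dir_nbr_le hA hy)) 1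

lemma dir_nbr_eq {A B : Finset E} {y : E} (hA : A.Nonempty) (hB : #B = rk B + 1) (hy : y ∈ B)
    (hcard : #(nbr A B y) = finrank ℝ (dir A ⊓ dir B : Submodule ℝ E) + 1) :
    dir (nbr A B y) = dir A ⊓ dir B := by
  refine Submodule.eq_of_le_of_finrank_le (dir_nbr_le hA hy) ?_
  rw [card_eq_of_subset_of_indep hB (nbr_subset A B y) ⟨y, self_mem_nbr hA hy⟩] at hcard
  exact le_of_eq (Nat.add_right_cancel hcard).symm

/-- When the neighbourhood has maximal size it already spans `dir A ⊓ dir B`; a further point of the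
same coset would violate the independence of `B`. -/
lemma mem_nbr_of_card_eq {A B : Finset E} {y y' : E} (hA : A.Nonempty) (hB : #B = rk B + 1)
    (hy : y ∈ B) (hcard : #(nbr A B y) = finrank ℝ (dir A ⊓ dir B : Submodule ℝ E) + 1)
    (hy' : y' ∈ B) (h : y' - y ∈ dir A) : y' ∈ nbr A B y := by
  by_contra hn
  have h1 : y' - y ∈ dir (nbr A B y) := by
    rw [dir_nbr_eq hA hB hy hcard]
    exact ⟨h, sub_mem_dir hy' hy⟩
  have h2 := dir_insert_of_mem (self_mem_nbr hA hy) h1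
  have h3 := card_eq_of_subset_of_indep hB (insert_subset hy' (nbr_subset A B y))
    (insert_nonempty _ _)
  have h4 := card_eq_of_subset_of_indep hB (nbr_subset A B y) ⟨y, self_mem_nbr hA hy⟩
  have h5 : rk (insert y' (nbr A B y)) = rk (nbr A B y) := by unfold rk; rw [h2]
  rw [card_insert_of_notMem hn, h5] at h3
  omega

/-- Two full cosets of `dir A ⊓ dir B` in an independent set coincide. -/
lemma sub_mem_dir_of_card_nbr {A B : Finset E} {y y' : E} (hA : A.Nonempty)
    (hB : #B = rk B + 1) (hy : y ∈ B) (hy' : y' ∈ B)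
    (hcard : #(nbr A B y) = finrank ℝ (dir A ⊓ dir B : Submodule ℝ E) + 1)
    (hcard' : #(nbr A B y') = finrank ℝ (dir A ⊓ dir B : Submodule ℝ E) + 1)
    (hc : 1 ≤ finrank ℝ (dir A ⊓ dir B : Submodule ℝ E)) : y' - y ∈ dir A := by
  by_contra hn
  have hd : Disjoint (nbr A B y) (nbr A B y') := by
    rw [disjoint_left]
    intro w hw hw'
    apply hn
    have h1 := sub_mem_dir hw (self_mem_nbr hA hy)
    have h2 := sub_mem_dir hw' (self_mem_nbr hA hy')
    have h3 := Submodule.sub_mem _ ((dir_nbr_le hA hy) h1).1 ((dir_nbr_le hA hy') h2).1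
    simpa using h3
  have h1 := card_eq_of_subset_of_indep hB
    (union_subset (nbr_subset A B y) (nbr_subset A B y'))
    ⟨y, mem_union_left _ (self_mem_nbr hA hy)⟩
  rw [card_union_of_disjoint hd, hcard, hcard'] at h1
  -- With `c = dim (dir A ⊓ dir B)`, two disjoint full neighbourhoods would give `2c + 2`
  -- independent points of rank at most `c + 1`, impossible for `c ≥ 1`.
  have h2 : rk (nbr A B y ∪ nbr A B y') ≤ finrank ℝ (dir A ⊓ dir B : Submodule ℝ E) + 1 := by
    have hle : dir (nbr A B y ∪ nbr A B y') ≤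
        (dir A ⊓ dir B) ⊔ Submodule.span ℝ {y' - y} := by
      refine (dir_le_iff (mem_union_left _ (self_mem_nbr hA hy))).2 fun w hw => ?_
      rcases mem_union.1 hw with hw | hw
      · exact Submodule.mem_sup_left (dir_nbr_le hA hy (sub_mem_dir hw (self_mem_nbr hA hy)))
      · have e : w - y = (w - y') + (y' - y) := by abel
        rw [e]
        exact Submodule.add_mem_sup
          (dir_nbr_le hA hy' (sub_mem_dir hw (self_mem_nbr hA hy')))
          (Submodule.mem_span_singleton_self _)
    refine (Submodule.finrank_mono hle).trans
      ((Submodule.finrank_add_le_finrank_add_finrank _ _).trans (Nat.add_le_add_left ?_ _))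
    have h := finrank_span_finset_le_card (R := ℝ) ({y' - y} : Finset E)
    rwa [coe_singleton, card_singleton] at h
  omega

/-- Representations with first entry `x` number at most `#B`. Any other is determined by its first
entry `u ≠ x`, a neighbour of `x`, since a nonzero difference in an independent set determines its
endpoints. -/
lemma sum_card_fib_le {A B : Finset E} (hB : #B = rk B + 1) {x : E} (hx : x ∈ A) :
    ∑ y ∈ B, #(fib A B (x + y)) + 1 ≤ #B + #(nbr B A x) := by
  have hBne : B.Nonempty := card_pos.1 (by omega)
  have hdisj : (B : Set E).PairwiseDisjoint fun y => fib A B (x + y) := by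
    intro y _ y' _ hne
    refine disjoint_left.2 fun ⟨u, v⟩ h h' => hne ?_
    exact add_left_cancel ((mem_fib.1 h).2.2.symm.trans (mem_fib.1 h').2.2)
  rw [← card_biUnion fun y hy y' hy' hne => hdisj hy hy' hne]
  set P := B.biUnion fun y => fib A B (x + y) with hP
  have hPm : ∀ {u v}, (u, v) ∈ P ↔ u ∈ A ∧ v ∈ B ∧ ∃ y ∈ B, u + v = x + y := by
    intro u v
    simp only [hP, mem_biUnion, mem_fib]
    constructor
    · rintro ⟨y, hy, hu, hv, he⟩
      exact ⟨hu, hv, y, hy, he⟩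
    · rintro ⟨hu, hv, y, hy, he⟩
      exact ⟨y, hy, hu, hv, he⟩
  have h1 : #(P.filter fun w => w.1 = x) ≤ #B := by
    refine card_le_card_of_injOn (fun w => w.2) ?_ ?_
    · rintro ⟨u, v⟩ h
      exact (hPm.1 (mem_filter.1 h).1).2.1
    · rintro ⟨u, v⟩ h ⟨u', v'⟩ h' he
      have e1 : u = x := (mem_filter.1 h).2
      have e2 : u' = x := (mem_filter.1 h').2
      have e3 : v = v' := he
      rw [e1, e2, e3]
  have h2 : #(P.filter fun w => ¬ w.1 = x) ≤ #((nbr B A x).erase x) := by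
    refine card_le_card_of_injOn (fun w => w.1) ?_ ?_
    · rintro ⟨u, v⟩ h
      obtain ⟨hm, hne⟩ := mem_filter.1 h
      obtain ⟨hu, hv, y, hy, he⟩ := hPm.1 hm
      refine mem_erase.2 ⟨hne, mem_nbr.2 ⟨hu, y, hy, v, hv, ?_⟩⟩
      rw [sub_eq_sub_iff_add_eq_add, he, add_comm]
    · rintro ⟨u, v⟩ h ⟨u', v'⟩ h' he
      obtain ⟨hm, hne⟩ := mem_filter.1 h
      obtain ⟨hm', _⟩ := mem_filter.1 h'
      obtain ⟨hu, hv, y, hy, he1⟩ := hPm.1 hm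
      obtain ⟨hu', hv', y', hy', he2⟩ := hPm.1 hm'
      have he : u = u' := he
      subst he
      have hvy : v ≠ y := by
        rintro rfl
        exact hne (add_right_cancel he1)
      have : v = v' := sub_eq_sub_of_indep hB hv hy hv' hy' hvy (by
        have e1 : v - y = x - u := by rw [sub_eq_sub_iff_add_eq_add, ← he1, add_comm]
        have e2 : v' - y' = x - u := by rw [sub_eq_sub_iff_add_eq_add, ← he2, add_comm]
        rw [e1, e2])
      rw [this]
  have h3 := card_erase_add_one (self_mem_nbr (A := B) hBne hx)
  have h4 := card_filter_add_card_filter_not (s := P) (fun w => w.1 = x)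
  omega

end

section

/-! ### Slack in the weighted inequality for independent pairs -/

section Slack

variable {E : Type*} [AddCommGroup E] [DecidableEq E]

/-- The excess of `val` over its lower bound by a multiplicity-weighted sum. -/
def slack (A B : Finset E) (α β : E → ℝ) (z : E) : ℝ :=
  val A B α β z - ∑ w ∈ fib A B z, (α w.1 + β w.2) * ((3 - #(fib A B z)) / 2)

/-- The gain at `x₀ + y` from adding a point `x₀` of weight zero. -/
def lineGain (A B : Finset E) (α β : E → ℝ) (x₀ y : E) : ℝ :=
  if x₀ + y ∈ A + B then max 0 (β y - val A B α β (x₀ + y)) else β y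

variable {A B : Finset E} {α β : E → ℝ}

/-- The factor `(3 - n) / 2` is 1 for a unique representation, 1/2 for two (so the average is
subtracted), and nonpositive from three on. With two, the excess of the maximum over the average is
half the difference. -/
lemma slack_ge_of_pair (hα : ∀ x ∈ A, 0 ≤ α x) (hβ : ∀ y ∈ B, 0 ≤ β y) {x y x' y' z : E}
    (h : (x, y) ∈ fib A B z) (h' : (x', y') ∈ fib A B z) (hne : (x, y) ≠ (x', y')) :
    ((α x + β y) - (α x' + β y')) / 2 ≤ slack A B α β z := by
  obtain ⟨hx, hy, hxy⟩ := mem_fib.1 h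
  obtain ⟨hx', hy', hxy'⟩ := mem_fib.1 h'
  have hv := le_val (α := α) (β := β) hx hy hxy
  have h0 := add_nonneg (hα x hx) (hβ y hy)
  have h0' := add_nonneg (hα x' hx') (hβ y' hy')
  have hsub : {(x, y), (x', y')} ⊆ fib A B z := by
    intro w hw
    rcases mem_insert.1 hw with rfl | hw
    · exact h
    · rw [mem_singleton.1 hw]; exact h'
  have hc2 := card_pair hne
  rcases (card_le_card hsub).eq_or_lt with he | hlt
  · have hfib := eq_of_subset_of_card_le hsub he.ge
    rw [slack, ← hfib, sum_pair hne, hc2]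
    norm_num
    linarith
  · have hc : (3 : ℝ) ≤ #(fib A B z) := by exact_mod_cast (by omega : 3 ≤ #(fib A B z))
    have hs : ∑ w ∈ fib A B z, (α w.1 + β w.2) * ((3 - #(fib A B z)) / 2) ≤ 0 := by
      refine sum_nonpos fun w hw => mul_nonpos_of_nonneg_of_nonpos ?_ (by linarith)
      obtain ⟨h1, h2, _⟩ := mem_fib.1 (show (w.1, w.2) ∈ fib A B z from hw)
      exact add_nonneg (hα _ h1) (hβ _ h2)
    unfold slack
    linarith

lemma val_le_slack (hα : ∀ x ∈ A, 0 ≤ α x) (hβ : ∀ y ∈ B, 0 ≤ β y) {z : E}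
    (h : 3 ≤ #(fib A B z)) : val A B α β z ≤ slack A B α β z := by
  have hc : (3 : ℝ) ≤ #(fib A B z) := by exact_mod_cast h
  have hs : ∑ w ∈ fib A B z, (α w.1 + β w.2) * ((3 - #(fib A B z)) / 2) ≤ 0 := by
    refine sum_nonpos fun w hw => mul_nonpos_of_nonneg_of_nonpos ?_ (by linarith)
    obtain ⟨h1, h2, _⟩ := mem_fib.1 (show (w.1, w.2) ∈ fib A B z from hw)
    exact add_nonneg (hα _ h1) (hβ _ h2)
  unfold slack
  linarith

lemma slack_nonneg (hα : ∀ x ∈ A, 0 ≤ α x) (hβ : ∀ y ∈ B, 0 ≤ β y) {z : E} (hz : z ∈ A + B) :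
    0 ≤ slack A B α β z := by
  obtain ⟨x, hx, y, hy, hxy⟩ := mem_add.1 hz
  have hm : (x, y) ∈ fib A B z := mem_fib.2 ⟨hx, hy, hxy⟩
  by_cases h : ∃ w ∈ fib A B z, w ≠ (x, y)
  · obtain ⟨⟨x', y'⟩, hw, hne⟩ := h
    have h1 := slack_ge_of_pair hα hβ hm hw hne.symm
    have h2 := slack_ge_of_pair hα hβ hw hm hne
    linarith
  · push Not at h
    have : fib A B z = {(x, y)} := eq_singleton_iff_unique_mem.2 ⟨hm, h⟩
    have hv := le_val (α := α) (β := β) hx hy hxy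
    rw [slack, this]
    simp only [sum_singleton, card_singleton]
    norm_num
    linarith

lemma lineGain_nonneg (hβ : ∀ y ∈ B, 0 ≤ β y) {x₀ y : E} (hy : y ∈ B) :
    0 ≤ lineGain A B α β x₀ y := by
  unfold lineGain
  split_ifs
  · exact le_max_left _ _
  · exact hβ y hy

lemma weight_insert_ge {x₀ : E} (hα : ∀ x ∈ A, 0 ≤ α x) (hβ : ∀ y ∈ B, 0 ≤ β y)
    (hα0 : α x₀ = 0) :
    weight A B α β + ∑ y ∈ B, lineGain A B α β x₀ y ≤ weight (insert x₀ A) B α β := by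
  have hsub : A + B ⊆ insert x₀ A + B := add_subset_add_right (subset_insert _ _)
  have hsub2 : B.image (x₀ + ·) ⊆ insert x₀ A + B := by
    intro z hz
    obtain ⟨y, hy, rfl⟩ := mem_image.1 hz
    exact add_mem_add (mem_insert_self _ _) hy
  have hα' : ∀ x ∈ insert x₀ A, 0 ≤ α x := by
    intro x hx
    rcases mem_insert.1 hx with rfl | hx
    · exact hα0.ge
    · exact hα x hx
  set g : E → ℝ := fun z => if z ∈ B.image (x₀ + ·) then lineGain A B α β x₀ (z - x₀) else 0
  set f : E → ℝ := fun z => if z ∈ A + B then val A B α β z else 0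
  have e1 : ∑ z ∈ insert x₀ A + B, f z = weight A B α β := by
    rw [← sum_filter, filter_mem_eq_inter, inter_eq_right.2 hsub, weight]
  have e2 : ∑ z ∈ insert x₀ A + B, g z = ∑ y ∈ B, lineGain A B α β x₀ y := by
    rw [← sum_filter, filter_mem_eq_inter, inter_eq_right.2 hsub2,
      sum_image fun y _ y' _ hyy => add_left_cancel hyy]
    simp
  rw [← e1, ← e2, ← sum_add_distrib]
  refine sum_le_sum fun z hz => ?_
  have hnn := val_nonneg hα' hβ hz
  simp only [f, g]
  by_cases hzB : z ∈ B.image (x₀ + ·)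
  · rw [if_pos hzB]
    obtain ⟨y, hy, rfl⟩ := mem_image.1 hzB
    have h1 := le_val (α := α) (β := β) (mem_insert_self x₀ A) hy rfl
    rw [hα0, zero_add] at h1
    rw [add_sub_cancel_left, lineGain]
    split_ifs with h2
    · have h3 := val_mono_set (α := α) (β := β) (subset_insert x₀ A) (subset_refl B) h2
      rcases max_cases 0 (β y - val A B α β (x₀ + y)) with h | h <;> linarith
    · linarith
  · rw [if_neg hzB, add_zero]
    split_ifs with h2
    · exact val_mono_set (subset_insert x₀ A) subset_rfl h2
    · exact hnn

lemma weight_eq_sum_slack :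
    weight A B α β = ∑ z ∈ A + B, slack A B α β z +
      ∑ x ∈ A, ∑ y ∈ B, (α x + β y) * ((3 - #(fib A B (x + y))) / 2) := by
  have h : ∑ x ∈ A, ∑ y ∈ B, (α x + β y) * ((3 - (#(fib A B (x + y)) : ℝ)) / 2) =
      ∑ z ∈ A + B, ∑ w ∈ fib A B z, (α w.1 + β w.2) * ((3 - #(fib A B z)) / 2) := by
    rw [← sum_product', ← sum_fiberwise_of_maps_to (s := A ×ˢ B) (t := A + B)
      (g := fun w => w.1 + w.2)
      (fun w hw => add_mem_add (mem_product.1 hw).1 (mem_product.1 hw).2)]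
    refine sum_congr rfl fun z _ => sum_congr rfl fun w hw => ?_
    rw [(mem_filter.1 hw).2]
  rw [h, ← sum_add_distrib, weight]
  refine sum_congr rfl fun z _ => ?_
  unfold slack
  ring

end Slack

variable {E : Type*} [AddCommGroup E] [Module ℝ E] [FiniteDimensional ℝ E] [DecidableEq E]

/-- By the count of representations, the factors at `x` sum to at least `#B - (#(nbr B A x) - 1) /
2`. With `c` the dimension of the common direction this is `#B - c / 2` plus half the deficit of the
neighbourhood. -/
lemma sum_mul_sub_card_fib_ge {A B : Finset E} {α : E → ℝ} (hB : #B = rk B + 1)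
    (hα : IsWt A α) {c : ℝ} :
    (#B : ℝ) - c / 2 + (∑ x ∈ A, α x * (c + 1 - #(nbr B A x))) / 2 ≤
      ∑ x ∈ A, ∑ y ∈ B, α x * ((3 - #(fib A B (x + y))) / 2) := by
  have h : ∀ x ∈ A, α x * (#B - c / 2) + α x * (c + 1 - #(nbr B A x)) / 2 ≤
      ∑ y ∈ B, α x * ((3 - #(fib A B (x + y))) / 2) := by
    intro x hx
    have h1 : (∑ y ∈ B, #(fib A B (x + y)) : ℝ) + 1 ≤ #B + #(nbr B A x) := by
      exact_mod_cast sum_card_fib_le hB hx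
    have h2 : ∑ y ∈ B, ((3 - (#(fib A B (x + y)) : ℝ)) / 2) =
        (3 * #B - ∑ y ∈ B, (#(fib A B (x + y)) : ℝ)) / 2 := by
      rw [← sum_div, sum_sub_distrib, sum_const, nsmul_eq_mul]
      ring
    rw [← mul_sum, h2]
    have h3 := mul_le_mul_of_nonneg_left (show (#B : ℝ) - c / 2 + (c + 1 - #(nbr B A x)) / 2 ≤
      (3 * #B - ∑ y ∈ B, (#(fib A B (x + y)) : ℝ)) / 2 by linarith) (hα.nonneg x hx)
    linarith
  have := sum_le_sum h
  rwa [sum_add_distrib, ← sum_mul, hα.sum_eq, one_mul, ← sum_div] at this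

/-- Summing both sides of the count gives `#A + #B - c`, which for independent sets equals `dim (dir
A ⊔ dir B) + 2`. The remaining terms are the nonnegative surpluses from which 1/6 is extracted. -/
lemma weight_insert_ge_of_indep {A B : Finset E} {x₀ : E} {α β : E → ℝ} (hA : #A = rk A + 1)
    (hB : #B = rk B + 1) (hα : IsWt A α) (hα0 : α x₀ = 0) (hβ : IsWt B β) {c : ℕ}
    (hc : c = finrank ℝ (dir A ⊓ dir B : Submodule ℝ E)) :
    (finrank ℝ (dir A ⊔ dir B : Submodule ℝ E) : ℝ) + 2 +
      (∑ x ∈ A, α x * (c + 1 - #(nbr B A x))) / 2 +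
      (∑ y ∈ B, β y * (c + 1 - #(nbr A B y))) / 2 +
      ∑ z ∈ A + B, slack A B α β z + ∑ y ∈ B, lineGain A B α β x₀ y ≤
      weight (insert x₀ A) B α β := by
  have h1 := weight_insert_ge (x₀ := x₀) hα.nonneg hβ.nonneg hα0
  rw [weight_eq_sum_slack] at h1
  have h2 := sum_mul_sub_card_fib_ge (c := c) hB hα
  have h3 := sum_mul_sub_card_fib_ge (c := c) hA hβ
  rw [sum_comm] at h3
  have hsymm : ∀ x y : E, #(fib B A (y + x)) = #(fib A B (x + y)) := by
    intro x y
    refine card_bij (fun w _ => (w.2, w.1)) ?_ ?_ ?_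
    · rintro ⟨u, v⟩ h
      obtain ⟨h1, h2, h3⟩ := mem_fib.1 h
      exact mem_fib.2 ⟨h2, h1, by rw [add_comm, h3, add_comm]⟩
    · rintro ⟨u, v⟩ _ ⟨u', v'⟩ _ h
      simp only [Prod.mk.injEq] at h
      rw [h.1, h.2]
    · rintro ⟨u, v⟩ h
      obtain ⟨h1, h2, h3⟩ := mem_fib.1 h
      exact ⟨(v, u), mem_fib.2 ⟨h2, h1, by rw [add_comm, h3, add_comm]⟩, rfl⟩
  simp only [hsymm] at h3
  have h4 : ∑ x ∈ A, ∑ y ∈ B, (α x + β y) * ((3 - (#(fib A B (x + y)) : ℝ)) / 2) =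
      ∑ x ∈ A, ∑ y ∈ B, α x * ((3 - (#(fib A B (x + y)) : ℝ)) / 2) +
      ∑ x ∈ A, ∑ y ∈ B, β y * ((3 - (#(fib A B (x + y)) : ℝ)) / 2) := by
    simp only [add_mul, sum_add_distrib]
  have h5 := Submodule.finrank_sup_add_finrank_inf_eq (dir A) (dir B)
  rw [← hc] at h5
  have h6 : (#A : ℝ) + #B = finrank ℝ (dir A ⊔ dir B : Submodule ℝ E) + c + 2 := by
    have h7 : #A + #B = finrank ℝ (dir A ⊔ dir B : Submodule ℝ E) + c + 2 := by
      rw [h5, hA, hB]; unfold rk; ring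
    exact_mod_cast h7
  linarith

end

section

variable {E : Type*} [AddCommGroup E] [Module ℝ E] [FiniteDimensional ℝ E] [DecidableEq E]

/-! ### Adding a point of weight zero to an independent pair -/

/-- The points `y` for which `x₀ + y ∈ A + B` and which lie in a full coset of
`dir A ⊓ dir B`. -/
def crit (A B : Finset E) (x₀ : E) : Finset E :=
  B.filter fun y => x₀ + y ∈ A + B ∧
    #(nbr A B y) = finrank ℝ (dir A ⊓ dir B : Submodule ℝ E) + 1

/-- The difference `y₁ - y = x₀ - q` lies in `dir A`, so fullness of the coset makes it a difference
`r - p` of points of `A`, which writes `x₀` as `q + r - p`. -/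
lemma exists_sub_eq_of_crit {A B : Finset E} {x₀ p₀ y q y₁ : E} (hB : #B = rk B + 1)
    (hx₀ : x₀ ∉ A) (hp₀ : p₀ ∈ A) (hx₀p : x₀ - p₀ ∈ dir A) (hy : y ∈ crit A B x₀) (hq : q ∈ A)
    (hy₁ : y₁ ∈ B) (h : x₀ + y = q + y₁) :
    y₁ ≠ y ∧ ∃ r ∈ A, ∃ p ∈ A, p ≠ q ∧ p ≠ r ∧ y₁ - y = r - p ∧ x₀ + p = q + r := by
  obtain ⟨hyB, hbad, hcard⟩ := mem_filter.1 hy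
  have hne : y₁ ≠ y := by
    rintro rfl
    exact hx₀ (add_right_cancel h ▸ hq)
  have e : y₁ - y = x₀ - q := by
    rw [sub_eq_sub_iff_add_eq_add, h, add_comm]
  have hdir : y₁ - y ∈ dir A := by
    rw [e]
    have := (dir A).add_mem hx₀p (sub_mem_dir hp₀ hq)
    simpa using this
  obtain ⟨-, r, hr, p, hp, hrp⟩ :=
    mem_nbr.1 (mem_nbr_of_card_eq ⟨q, hq⟩ hB hyB hcard hy₁ hdir)
  have hx : x₀ + p = q + r := by
    have e2 : x₀ - q = r - p := by rw [← e, hrp]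
    rw [sub_eq_sub_iff_add_eq_add] at e2
    rw [e2, add_comm]
  refine ⟨hne, r, hr, p, hp, ?_, ?_, hrp, hx⟩
  · rintro rfl
    rw [add_comm p r] at hx
    exact hx₀ (add_right_cancel hx ▸ hr)
  · rintro rfl
    exact hx₀ (add_right_cancel hx ▸ hq)

lemma add_sub_unique {A : Finset E} (hA : #A = rk A + 1) {x₀ p q r p' q' r' : E} (hp : p ∈ A)
    (hq : q ∈ A) (hr : r ∈ A) (hp' : p' ∈ A) (hq' : q' ∈ A) (hr' : r' ∈ A) (hpq : p ≠ q)
    (hpr : p ≠ r) (h : x₀ + p = q + r) (h' : x₀ + p' = q' + r') :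
    p = p' ∧ ((q = q' ∧ r = r') ∨ (q = r' ∧ r = q')) := by
  have e : p + q' + r' = p' + q + r := by
    rw [add_assoc, ← h', add_assoc, ← h]
    abel
  have hpp : p = p' := by
    rcases indep_sum₃_mem hA hp hq' hr' hp' hq hr e with h1 | h1 | h1
    · exact h1
    · exact absurd h1 hpq
    · exact absurd h1 hpr
  subst hpp
  refine ⟨rfl, indep_sum₂ hA hq hr hq' hr' ?_⟩
  rw [← h, ← h']

/-- The expression `x₀ = q + r - p` is unique up to exchanging `q` and `r`, so a critical point is
the start of the difference `r - p` or `q - p` in `B`. This allows at most two critical points, and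
fullness forces both differences to end at the same point. -/
lemma exists_triple_of_two_crit {A B : Finset E} {x₀ p₀ y y' : E} (hA : #A = rk A + 1)
    (hB : #B = rk B + 1) (hx₀ : x₀ ∉ A) (hp₀ : p₀ ∈ A) (hx₀p : x₀ - p₀ ∈ dir A)
    (hy : y ∈ crit A B x₀) (hy' : y' ∈ crit A B x₀) (hyy : y ≠ y') :
    (∃ p ∈ A, ∃ q ∈ A, ∃ r ∈ A, ∃ y₁ ∈ B, p ≠ q ∧ p ≠ r ∧ q ≠ r ∧ p + y₁ = r + y ∧
      r + y = q + y') ∧ crit A B x₀ ⊆ {y, y'} := by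
  have hAne : A.Nonempty := ⟨p₀, hp₀⟩
  obtain ⟨hyB, hbad, hcard⟩ := mem_filter.1 hy
  obtain ⟨hyB', hbad', hcard'⟩ := mem_filter.1 hy'
  obtain ⟨q, hq, y₁, hy₁, he⟩ := mem_add.1 hbad
  obtain ⟨q₂, hq₂, y₂, hy₂, he₂⟩ := mem_add.1 hbad'
  obtain ⟨hne, r, hr, p, hp, hpq, hpr, hd, hx⟩ :=
    exists_sub_eq_of_crit hB hx₀ hp₀ hx₀p hy hq hy₁ he.symm
  have hdiff : ∀ {w w' v v' : E}, w ∈ B → w' ∈ B → v ∈ B → v' ∈ B → w' ≠ w →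
      w' - w = v' - v → w = v := by
    intro w w' v v' hw hw' hv hv' hne h
    refine sub_eq_sub_of_indep hB hw hw' hv hv' hne.symm ?_
    rw [← neg_sub w' w, h, neg_sub]
  -- the difference attached to a critical point is `r - p` or `q - p`
  have huniq : ∀ {w q' w' : E}, w ∈ crit A B x₀ → q' ∈ A → w' ∈ B → x₀ + w = q' + w' →
      w' ≠ w ∧ (w' - w = r - p ∨ w' - w = q - p) := by
    intro w q' w' hw hq' hw' hew
    obtain ⟨hne', r', hr', p', hp', hpq', hpr', hd', hx'⟩ :=
      exists_sub_eq_of_crit hB hx₀ hp₀ hx₀p hw hq' hw' hew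
    refine ⟨hne', ?_⟩
    obtain ⟨rfl, h | h⟩ := add_sub_unique hA hp hq hr hp' hq' hr' hpq hpr hx hx'
    · left; rw [hd', h.2]
    · right; rw [hd', h.1]
  obtain ⟨hne₂, hd₂⟩ := huniq hy' hq₂ hy₂ he₂.symm
  have hd₂' : y₂ - y' = q - p := by
    rcases hd₂ with h | h
    · exact absurd (hdiff hyB hy₁ hyB' hy₂ hne (by rw [hd, h])) hyy
    · exact h
  have hqr : q ≠ r := by
    rintro rfl
    exact hyy (hdiff hyB hy₁ hyB' hy₂ hne (by rw [hd, hd₂']))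
  refine ⟨?_, ?_⟩
  swap
  · intro w hw
    obtain ⟨hwB, hwbad, -⟩ := mem_filter.1 hw
    obtain ⟨q', hq', w', hw', hew⟩ := mem_add.1 hwbad
    obtain ⟨hnew, h | h⟩ := huniq hw hq' hw' hew.symm
    · rw [hdiff hwB hw' hyB hy₁ hnew (by rw [h, hd])]; simp
    · rw [hdiff hwB hw' hyB' hy₂ hnew (by rw [h, hd₂'])]; simp
  -- full cosets
  have hc : 1 ≤ finrank ℝ (dir A ⊓ dir B : Submodule ℝ E) := by
    rw [Nat.one_le_iff_ne_zero]
    intro h0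
    have h1 : y₁ - y ∈ dir A ⊓ dir B :=
      ⟨by rw [hd]; exact sub_mem_dir hr hp, sub_mem_dir hy₁ hyB⟩
    rw [Submodule.finrank_eq_zero.1 h0, Submodule.mem_bot, sub_eq_zero] at h1
    exact hne h1
  have hyy'dir := sub_mem_dir_of_card_nbr hAne hB hyB hyB' hcard hcard' hc
  have hd1 : y₁ - y ∈ dir A := by rw [hd]; exact sub_mem_dir hr hp
  have hd2 : y₂ - y' ∈ dir A := by rw [hd₂']; exact sub_mem_dir hq hp
  have hx0dir : ∀ a ∈ A, x₀ - a ∈ dir A := fun a ha => by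
    have := (dir A).add_mem hx₀p (sub_mem_dir hp₀ ha)
    simpa using this
  -- degenerate coincidences would give `x₀ + u' = p + u`
  have hdeg : ∀ u ∈ A, ∀ u' ∈ A, x₀ + u' = p + u → False := by
    intro u hu u' hu' h
    have h3 : p + p + u = q + r + u' := by
      rw [add_assoc, ← h, ← hx]; abel
    rcases indep_sum₃_mem hA hp hp hu hq hr hu' h3 with h4 | h4 | h4
    · exact hpq h4
    · exact hpr h4
    · subst h4
      rw [add_comm p u] at h
      exact hx₀ (add_right_cancel h ▸ hu)
  have h1' : y₁ ≠ y' := by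
    rintro rfl
    obtain ⟨-, u, hu, u', hu', hu2⟩ := mem_nbr.1 (mem_nbr_of_card_eq hAne hB hyB hcard hy₂ (by
      have := (dir A).add_mem hd2 hd1
      simpa using this))
    refine hdeg u hu u' hu' ?_
    have e1 : u - u' = (q - p) + (r - p) := by rw [← hu2, ← hd₂', ← hd]; abel
    have e2 : x₀ = q + r - p := by rw [← hx]; abel
    rw [← sub_eq_zero, e2]
    rw [← sub_eq_zero] at e1
    rw [← neg_eq_zero, ← e1]
    abel
  have h2' : y₂ ≠ y := by
    rintro rfl
    obtain ⟨-, u, hu, u', hu', hu2⟩ := mem_nbr.1 (mem_nbr_of_card_eq hAne hB hyB' hcard' hy₁ (by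
      have := (dir A).add_mem hd1 hd2
      simpa using this))
    refine hdeg u hu u' hu' ?_
    have e1 : u - u' = (q - p) + (r - p) := by rw [← hu2, ← hd₂', ← hd]; abel
    have e2 : x₀ = q + r - p := by rw [← hx]; abel
    rw [← sub_eq_zero, e2]
    rw [← sub_eq_zero] at e1
    rw [← neg_eq_zero, ← e1]
    abel
  obtain ⟨-, w, hw, w', hw', hww⟩ :=
    mem_nbr.1 (mem_nbr_of_card_eq hAne hB hyB hcard hyB' hyy'dir)
  obtain ⟨-, x, hx1, x', hx1', hxx⟩ := mem_nbr.1 (mem_nbr_of_card_eq hAne hB hyB hcard hy₂ (by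
    have := (dir A).add_mem hd2 hyy'dir
    simpa using this))
  obtain ⟨-, u, hu, u', hu', huu⟩ := mem_nbr.1 (mem_nbr_of_card_eq hAne hB hyB' hcard' hy₁ (by
    have := (dir A).sub_mem hd1 hyy'dir
    simpa using this))
  have hwne : w ≠ w' := by
    rintro rfl
    rw [sub_self, sub_eq_zero] at hww
    exact hyy hww.symm
  have hxne : x ≠ x' := by
    rintro rfl
    rw [sub_self, sub_eq_zero] at hxx
    exact h2' hxx
  have hune : u ≠ u' := by
    rintro rfl
    rw [sub_self, sub_eq_zero] at huu
    exact h1' huu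
  have hs1 : p + x + w' = q + w + x' := by
    have e1 : x - x' = (q - p) + (w - w') := by rw [← hxx, ← hd₂', ← hww]; abel
    rw [← sub_eq_zero] at e1 ⊢
    rw [← e1]; abel
  have hs2 : p + u + w = r + w' + u' := by
    have e1 : u - u' = (r - p) - (w - w') := by rw [← huu, ← hd, ← hww]; abel
    rw [← sub_eq_zero] at e1 ⊢
    rw [← e1]; abel
  -- Comparing terms in the two three-term relations over the independent set `A` leaves only this
  -- matching.
  have hfin : u = q ∧ u' = p := by
    have t1 := indep_sum₃ hA hp hx1 hw' hq hw hx1' hs1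
    have t2 := indep_sum₃ hA hp hu hw hr hw' hu' hs2
    grind
  have hyy1 : y₁ = y₂ := by
    have : y₁ - y' = y₂ - y' := by rw [huu, hd₂', hfin.1, hfin.2]
    exact sub_left_injective this
  refine ⟨p, hp, q, hq, r, hr, y₁, hy₁, hpq, hpr, hqr, ?_, ?_⟩
  · rw [← sub_eq_zero] at hd ⊢
    rw [← hd]; abel
  · rw [hyy1] at hd
    have e : (r - p) - (q - p) = y' - y := by rw [← hd, ← hd₂']; abel
    rw [← sub_eq_zero] at e ⊢
    rw [← e]; abel

/-- If the neighbourhood of `q` were full, a relation `y₁ + y₁ + w' = y + y₃ + w` would hold in `B`.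
Independence requires `y₁` twice on the right, yet it differs from `y` and `y₃`. -/
lemma card_nbr_le_of_crit {A B : Finset E} {x₀ y q y₁ : E} (hA : #A = rk A + 1)
    (hB : #B = rk B + 1) (hx₀ : x₀ ∉ A) (hy : y ∈ B) (hq : q ∈ A) (hy₁ : y₁ ∈ B) (hne : y₁ ≠ y)
    (h : x₀ + y = q + y₁) (hbad : x₀ + y₁ ∈ A + B) :
    #(nbr B A q) ≤ finrank ℝ (dir A ⊓ dir B : Submodule ℝ E) := by
  have hBne : B.Nonempty := ⟨y, hy⟩
  have hle := card_nbr_le (A := B) (B := A) hBne hA hq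
  rw [inf_comm] at hle
  by_contra hc
  obtain ⟨x₃, hx₃, y₃, hy₃, he⟩ := mem_add.1 hbad
  have hx3 : x₃ - q = (y₁ - y) + (y₁ - y₃) := by
    rw [← sub_eq_zero] at h he ⊢
    have : x₃ - q - (y₁ - y + (y₁ - y₃)) = (x₃ + y₃ - (x₀ + y₁)) + (x₀ + y - (q + y₁)) := by abel
    rw [this, h, he, add_zero]
  obtain ⟨-, w, hw, w', hw', hww⟩ := mem_nbr.1 (mem_nbr_of_card_eq (A := B) (B := A) (y' := x₃)
    hBne hA hq (by rw [inf_comm]; omega) hx₃ (by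
      rw [hx3]
      exact (dir B).add_mem (sub_mem_dir hy₁ hy) (sub_mem_dir hy₁ hy₃)))
  have hs : y₁ + y₁ + w' = y + y₃ + w := by
    rw [hx3] at hww
    rw [← sub_eq_zero] at hww ⊢
    rw [← hww]; abel
  have hne3 : y₁ ≠ y₃ := by
    rintro rfl
    exact hx₀ (add_right_cancel he ▸ hx₃)
  have t := indep_sum₃ hB hy₁ hy₁ hw' hy hy₃ hw hs
  grind

lemma IsWt.add_le_one {F : Type*} {A : Finset F} {α : F → ℝ} (h : IsWt A α) {x y : F}
    (hx : x ∈ A) (hy : y ∈ A) (hne : x ≠ y) : α x + α y ≤ 1 := by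
  classical
  rw [← h.sum_eq, ← sum_pair hne]
  refine sum_le_sum_of_subset_of_nonneg ?_ fun z hz _ => h.nonneg z hz
  intro z hz
  rcases mem_insert.1 hz with rfl | hz
  · exact hx
  · rw [mem_singleton.1 hz]; exact hy

/-- The gap bound when `A ∪ {x₀}` is dependent only because of a point `x₀` of weight zero. -/
lemma near_indep_bound {A B : Finset E} {x₀ p₀ : E} {α β : E → ℝ} (hA : #A = rk A + 1)
    (hB : #B = rk B + 1) (hx₀ : x₀ ∉ A) (hp₀ : p₀ ∈ A) (hx₀p : x₀ - p₀ ∈ dir A) (hα : IsWt A α)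
    (hα0 : α x₀ = 0) (hβ : IsWt B β) :
    (finrank ℝ (dir A ⊔ dir B : Submodule ℝ E) : ℝ) + 2 + 1 / 6 ≤ weight (insert x₀ A) B α β := by
  have hAne : A.Nonempty := ⟨p₀, hp₀⟩
  have hBne : B.Nonempty := card_pos.1 (by omega)
  obtain ⟨c, hc⟩ : ∃ c, c = finrank ℝ (dir A ⊓ dir B : Submodule ℝ E) := ⟨_, rfl⟩
  refine le_trans ?_ (weight_insert_ge_of_indep hA hB hα hα0 hβ hc)
  set S₁ := ∑ x ∈ A, α x * ((c : ℝ) + 1 - #(nbr B A x)) with hS₁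
  set S₃ := ∑ z ∈ A + B, slack A B α β z with hS₃
  set h : E → ℝ := fun y => β y * ((c : ℝ) + 1 - #(nbr A B y)) / 2 + lineGain A B α β x₀ y with hh
  have hsum : (∑ y ∈ B, β y * ((c : ℝ) + 1 - #(nbr A B y))) / 2 +
      ∑ y ∈ B, lineGain A B α β x₀ y = ∑ y ∈ B, h y := by
    rw [hh, sum_add_distrib, sum_div]
  have hnbrB : ∀ y ∈ B, (#(nbr A B y) : ℝ) ≤ c + 1 := fun y hy => by
    rw [hc]; exact_mod_cast card_nbr_le hAne hB hy
  have hnbrA : ∀ x ∈ A, (#(nbr B A x) : ℝ) ≤ c + 1 := fun x hx => by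
    rw [hc, inf_comm]; exact_mod_cast card_nbr_le hBne hA hx
  have hT₁ : ∀ x ∈ A, 0 ≤ α x * ((c : ℝ) + 1 - #(nbr B A x)) := fun x hx =>
    mul_nonneg (hα.nonneg x hx) (by linarith [hnbrA x hx])
  have hS₁0 : 0 ≤ S₁ := sum_nonneg hT₁
  have hsl : ∀ z ∈ A + B, 0 ≤ slack A B α β z := fun z hz => slack_nonneg hα.nonneg hβ.nonneg hz
  have hS₃0 : 0 ≤ S₃ := sum_nonneg hsl
  have hS₃z : ∀ z ∈ A + B, slack A B α β z ≤ S₃ := fun z hz => single_le_sum hsl hz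
  have hT₂ : ∀ y ∈ B, 0 ≤ β y * ((c : ℝ) + 1 - #(nbr A B y)) := fun y hy =>
    mul_nonneg (hβ.nonneg y hy) (by linarith [hnbrB y hy])
  have hgain : ∀ y ∈ B, 0 ≤ lineGain A B α β x₀ y := fun y hy => lineGain_nonneg hβ.nonneg hy
  have hhgain : ∀ y ∈ B, lineGain A B α β x₀ y ≤ h y := fun y hy => by
    have := hT₂ y hy
    simp only [hh]; linarith
  have hh0 : ∀ y ∈ B, 0 ≤ h y := fun y hy => (hgain y hy).trans (hhgain y hy)
  have hgood : ∀ y ∈ B, x₀ + y ∉ A + B → β y ≤ h y := fun y hy hg => by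
    have := hhgain y hy
    rwa [lineGain, if_neg hg] at this
  have hcritB : crit A B x₀ ⊆ B := filter_subset _ _
  -- A noncritical point either creates a new sum, gaining `β y`, or has a neighbourhood deficit of
  -- at least one, gaining `β y / 2`.
  have hnc : ∀ y ∈ B \ crit A B x₀, β y / 2 ≤ h y := by
    intro y hy
    obtain ⟨hyB, hyc⟩ := mem_sdiff.1 hy
    have hb := hβ.nonneg y hyB
    by_cases hg : x₀ + y ∈ A + B
    · have hlt : #(nbr A B y) ≤ c := by
        have h1 := card_nbr_le hAne hB hyB
        by_contra hcon
        exact hyc (mem_filter.2 ⟨hyB, hg, by omega⟩)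
      have hlt' : (#(nbr A B y) : ℝ) ≤ c := by exact_mod_cast hlt
      have h2 := mul_le_mul_of_nonneg_left
        (show (1 : ℝ) ≤ (c : ℝ) + 1 - #(nbr A B y) by linarith) hb
      have h3 := hgain y hyB
      simp only [hh]; linarith
    · have := hgood y hyB hg
      linarith
  have hsplit : ∀ f : E → ℝ, ∑ y ∈ B \ crit A B x₀, f y + ∑ y ∈ crit A B x₀, f y = ∑ y ∈ B, f y :=
    fun f => sum_sdiff hcritB
  have hβs := hsplit β
  rw [hβ.sum_eq] at hβs
  have hhs := hsplit h
  have hncs : (∑ y ∈ B \ crit A B x₀, β y) / 2 ≤ ∑ y ∈ B \ crit A B x₀, h y := by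
    rw [sum_div]; exact sum_le_sum hnc
  have hcs0 : 0 ≤ ∑ y ∈ crit A B x₀, h y := sum_nonneg fun y hy => hh0 y (hcritB hy)
  suffices hmain : 1 / 6 ≤ S₁ / 2 + S₃ + ∑ y ∈ B, h y by linarith
  rcases (crit A B x₀).eq_empty_or_nonempty with hemp | ⟨y, hy⟩
  · have h0 : ∑ y ∈ crit A B x₀, β y = 0 := by rw [hemp, sum_empty]
    linarith
  obtain ⟨hyB, hbad, hcard⟩ := mem_filter.1 hy
  by_cases htwo : ∃ y' ∈ crit A B x₀, y' ≠ y
  · obtain ⟨y', hy', hne⟩ := htwo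
    obtain ⟨⟨p, hp, q, hq, r, hr, y₁, hy₁, hpq, hpr, hqr, e1, e2⟩, hsub⟩ :=
      exists_triple_of_two_crit hA hB hx₀ hp₀ hx₀p hy hy' hne.symm
    have hz : r + y ∈ A + B := add_mem_add hr hyB
    have h3 : 3 ≤ #(fib A B (r + y)) := by
      have hs : ({(p, y₁), (q, y'), (r, y)} : Finset (E × E)) ⊆ fib A B (r + y) := by
        intro w hw
        simp only [mem_insert, mem_singleton] at hw
        rcases hw with rfl | rfl | rfl
        · exact mem_fib.2 ⟨hp, hy₁, e1⟩
        · exact mem_fib.2 ⟨hq, hcritB hy', e2.symm⟩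
        · exact mem_fib.2 ⟨hr, hyB, rfl⟩
      refine le_trans (le_of_eq ?_) (card_le_card hs)
      rw [card_eq_three.2]
      refine ⟨_, _, _, ?_, ?_, ?_, rfl⟩
      · exact fun h => hpq (congrArg Prod.fst h)
      · exact fun h => hpr (congrArg Prod.fst h)
      · exact fun h => hqr (congrArg Prod.fst h)
    -- The slack at the triple sum is at least `max (β y) (β y')`, hence at least half of their
    -- total; with the noncritical half this makes 1/2.
    have h4 := val_le_slack hα.nonneg hβ.nonneg h3
    have h5 := le_val (α := α) (β := β) hr hyB rfl
    have h6 := le_val (α := α) (β := β) hq (hcritB hy') e2.symm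
    have h7 := hS₃z _ hz
    have h8 := hα.nonneg r hr
    have h9 := hα.nonneg q hq
    have h10 : ∑ y ∈ crit A B x₀, β y ≤ β y + β y' := by
      rw [← sum_pair hne.symm]
      refine sum_le_sum_of_subset_of_nonneg hsub fun w hw _ => ?_
      rcases mem_insert.1 hw with rfl | hw
      · exact hβ.nonneg _ hyB
      · rw [mem_singleton.1 hw]; exact hβ.nonneg _ (hcritB hy')
    linarith
  · push Not at htwo
    have hcr : crit A B x₀ = {y} := eq_singleton_iff_unique_mem.2 ⟨hy, htwo⟩
    rw [hcr, sum_singleton] at hβs hhs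
    rw [hcr] at hncs hnc
    obtain ⟨q, hq, y₁, hy₁, he, hv⟩ := exists_val (α := α) (β := β) hbad
    obtain ⟨hne, r, hr, p, hp, hpq, hpr, hd, hx⟩ :=
      exists_sub_eq_of_crit hB hx₀ hp₀ hx₀p hy hq hy₁ he.symm
    have hry : r + y = p + y₁ := by
      rw [← sub_eq_zero] at hd ⊢
      rw [← neg_eq_zero, ← hd]; abel
    have hsl₁ := slack_ge_of_pair hα.nonneg hβ.nonneg (mem_fib.2 ⟨hr, hyB, rfl⟩)
      (mem_fib.2 ⟨hp, hy₁, hry.symm⟩) (fun h => hpr (congrArg Prod.fst h).symm)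
    have hsl₂ := hS₃z _ (add_mem_add hr hyB)
    have hαr := hα.nonneg r hr
    have hαq := hα.nonneg q hq
    have hαpq := hα.add_le_one hp hq hpq
    have hββ := hβ.add_le_one hy₁ hyB hne
    have hβ₁ := hβ.nonneg y₁ hy₁
    have hgy := hhgain y hyB
    have hγ0 := hgain y hyB
    have hγ : β y - (α q + β y₁) ≤ lineGain A B α β x₀ y := by
      rw [lineGain, if_pos hbad, ← hv]
      exact le_max_right _ _
    -- If `x₀ + y₁` is an old sum, the neighbourhood deficit at `q` contributes `α q`; otherwise
    -- `y₁` contributes its full weight rather than half.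
    by_cases hgy₁ : x₀ + y₁ ∈ A + B
    · have hlt := card_nbr_le_of_crit hA hB hx₀ hyB hq hy₁ hne he.symm hgy₁
      rw [← hc] at hlt
      have hlt' : (#(nbr B A q) : ℝ) ≤ c := by exact_mod_cast hlt
      have h2 := mul_le_mul_of_nonneg_left
        (show (1 : ℝ) ≤ (c : ℝ) + 1 - #(nbr B A q) by linarith) hαq
      have h3 : α q * ((c : ℝ) + 1 - #(nbr B A q)) ≤ S₁ := single_le_sum hT₁ hq
      linarith
    · have hmem : y₁ ∈ B \ {y} := mem_sdiff.2 ⟨hy₁, by simpa using hne⟩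
      have h1 := hgood y₁ hy₁ hgy₁
      have h2 : ∑ w ∈ (B \ {y}).erase y₁, β w / 2 ≤ ∑ w ∈ (B \ {y}).erase y₁, h w :=
        sum_le_sum fun w hw => hnc w (mem_of_mem_erase hw)
      have h3 := add_sum_erase (B \ {y}) h hmem
      have h4 := add_sum_erase (B \ {y}) β hmem
      rw [← sum_div] at h2
      linarith

end

section

variable {E : Type*} [AddCommGroup E] [Module ℝ E]

/-! ### The gap theorem for weighted sumsets -/

/-- The lower bound in the gap theorem. -/
def gap (A B : Finset E) : ℝ :=
  (finrank ℝ (dir A ⊔ dir B : Submodule ℝ E) : ℝ) + 2 +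
    (if rk A + 2 ≤ #A ∨ rk B + 2 ≤ #B then 1 / 6 else 0)

lemma gap_comm (A B : Finset E) : gap A B = gap B A := by
  unfold gap
  rw [sup_comm]
  simp only [or_comm]

variable [FiniteDimensional ℝ E] [DecidableEq E]

lemma gap_le_of_zero {A B : Finset E} {α β : E → ℝ} {x : E} (hα : IsWt A α) (hβ : IsWt B β)
    (hx : x ∈ A) (hαx : α x = 0) (h : gap (A.erase x) B ≤ weight (A.erase x) B α β) :
    gap A B ≤ weight A B α β := by
  have hα' := hα.erase hx hαx
  obtain ⟨p, hp⟩ : (A.erase x).Nonempty := by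
    rw [nonempty_iff_ne_empty]
    intro h0
    have := hα'.sum_eq
    simp [h0] at this
  have hins : insert x (A.erase x) = A := insert_erase hx
  have hcard := card_erase_add_one hx
  have hdirA : dir A = dir (A.erase x) ⊔ Submodule.span ℝ {x - p} := by
    rw [← dir_insert hp, hins]
  have h1 := rk_add_one_le_card ⟨p, hp⟩
  have hBne : B.Nonempty := by
    rw [nonempty_iff_ne_empty]
    intro h0
    have := hβ.sum_eq
    simp [h0] at this
  have h1B := rk_add_one_le_card hBne
  -- If the dimension is unchanged, monotonicity suffices unless dependence is lost. If it rises by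
  -- one, `x + B` is disjoint from the remaining sums and carries the extra mass 1.
  by_cases hmem : x - p ∈ dir (A.erase x) ⊔ dir B
  · have hm : dir A ⊔ dir B = dir (A.erase x) ⊔ dir B := by
      rw [hdirA, sup_right_comm]
      exact sup_eq_left.2 ((Submodule.span_singleton_le_iff_mem _ _).2 hmem)
    have hw := weight_le_of_subset (A' := A.erase x) hα.nonneg hβ.nonneg (erase_subset x A)
    by_cases hd : rk (A.erase x) + 2 ≤ #(A.erase x) ∨ rk B + 2 ≤ #B
    · refine le_trans ?_ (h.trans hw)
      unfold gap
      rw [hm, if_pos hd]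
      split_ifs <;> linarith
    · by_cases hdA : rk A + 2 ≤ #A
      · rw [not_or] at hd
        have hxp : x - p ∈ dir (A.erase x) := by
          rw [dir_eq_of_rk_le (erase_subset x A) (by omega)]
          exact sub_mem_dir hx (mem_of_mem_erase hp)
        have hN := near_indep_bound (by omega) (by omega) (notMem_erase x A) hp hxp hα' hαx hβ
        rw [hins, ← hm] at hN
        unfold gap
        rwa [if_pos (Or.inl hdA)]
      · refine le_trans ?_ (h.trans hw)
        unfold gap
        rw [hm, if_neg hd, if_neg (by tauto)]
  · have hw := weight_add_sum_le_of_disjoint hα.nonneg hβ.nonneg hx (fun y hy hxy => by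
      obtain ⟨x', hx', y', hy', he⟩ := mem_add.1 hxy
      apply hmem
      have e : x - p = (x' - p) + (y' - y) := by
        rw [← sub_eq_zero] at he ⊢
        rw [← neg_eq_zero, ← he]
        abel
      rw [e]
      exact Submodule.add_mem_sup (sub_mem_dir hx' hp) (sub_mem_dir hy' hy))
    rw [hβ.sum_eq] at hw
    have hm : finrank ℝ (dir A ⊔ dir B : Submodule ℝ E) ≤
        finrank ℝ (dir (A.erase x) ⊔ dir B : Submodule ℝ E) + 1 := by
      rw [hdirA, sup_right_comm]
      refine (Submodule.finrank_add_le_finrank_add_finrank _ _).trans (Nat.add_le_add_left ?_ _)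
      have h := finrank_span_finset_le_card (R := ℝ) ({x - p} : Finset E)
      rwa [coe_singleton, card_singleton] at h
    have hm' : (finrank ℝ (dir A ⊔ dir B : Submodule ℝ E) : ℝ) ≤
        finrank ℝ (dir (A.erase x) ⊔ dir B : Submodule ℝ E) + 1 := by exact_mod_cast hm
    have hrk : rk (A.erase x) < rk A := by
      by_contra hc
      apply hmem
      rw [dir_eq_of_rk_le (erase_subset x A) (not_lt.1 hc)]
      exact Submodule.mem_sup_left (sub_mem_dir hx (mem_of_mem_erase hp))
    have hd : (rk A + 2 ≤ #A ∨ rk B + 2 ≤ #B) →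
        (rk (A.erase x) + 2 ≤ #(A.erase x) ∨ rk B + 2 ≤ #B) := by omega
    unfold gap at h ⊢
    split_ifs at h ⊢ <;> first | linarith | tauto

theorem gap_le_weight {A B : Finset E} {α β : E → ℝ} (hα : IsWt A α) (hβ : IsWt B β) :
    gap A B ≤ weight A B α β := by
  have hne : ∀ {A : Finset E} {α : E → ℝ}, IsWt A α → A.Nonempty := by
    intro A α h
    rw [nonempty_iff_ne_empty]
    rintro rfl
    simpa using h.sum_eq
  induction hn : #A + #B using Nat.strong_induction_on generalizing A B α β with
  | _ n ih =>
  have hA := hne hα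
  have hB := hne hβ
  obtain ⟨α₀, β₀, hα₀, hβ₀, hmin⟩ := exists_minimizer hA hB
  refine le_trans ?_ (hmin α β hα hβ)
  by_cases hzA : ∃ x ∈ A, α₀ x = 0
  · obtain ⟨x, hx, hx0⟩ := hzA
    refine gap_le_of_zero hα₀ hβ₀ hx hx0 (ih _ ?_ (hα₀.erase hx hx0) hβ₀ rfl)
    have := card_erase_add_one hx
    omega
  by_cases hzB : ∃ y ∈ B, β₀ y = 0
  · obtain ⟨y, hy, hy0⟩ := hzB
    rw [gap_comm, weight_comm]
    refine gap_le_of_zero hβ₀ hα₀ hy hy0 (ih _ ?_ (hβ₀.erase hy hy0) hα₀ rfl)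
    have := card_erase_add_one hy
    omega
  push Not at hzA hzB
  have hpA : ∀ x ∈ A, 0 < α₀ x := fun x hx => lt_of_le_of_ne (hα₀.nonneg x hx) (hzA x hx).symm
  have hpB : ∀ y ∈ B, 0 < β₀ y := fun y hy => lt_of_le_of_ne (hβ₀.nonneg y hy) (hzB y hy).symm
  have hI : ∀ X Y : Finset E, X.Nonempty → Y.Nonempty → #X + #Y < #A + #B →
      gap X Y ≤ #(X + Y) * ((#X : ℝ)⁻¹ + (#Y : ℝ)⁻¹) := by
    intro X Y hX hY hlt
    rw [← weight_unif]
    exact ih _ (by omega) (isWt_unif hX subset_rfl) (isWt_unif hY subset_rfl) rfl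
  have hAB := fun hdep => role_bound (A := A) (B := B) (α := α₀) (β := β₀)
    (lam := weight A B α₀ β₀) hA hB
    (fun ρ σ L hρ hσ hL => sum_le_weight_of_minimizer hα₀ hβ₀ hpA hpB hmin hρ hσ hL)
    (fun X _ Y _ hX hY hlt => hI X Y hX hY hlt) hdep
  have hmin' : ∀ β' α' : E → ℝ, IsWt B β' → IsWt A α' →
      weight B A β₀ α₀ ≤ weight B A β' α' := by
    intro β' α' hβ' hα'
    rw [weight_comm B A, weight_comm B A]
    exact hmin α' β' hα' hβ'
  have hBA := fun hdep => role_bound (A := B) (B := A) (α := β₀) (β := α₀)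
    (lam := weight B A β₀ α₀) hB hA
    (fun ρ σ L hρ hσ hL => sum_le_weight_of_minimizer hβ₀ hα₀ hpB hpA hmin' hρ hσ hL)
    (fun X _ Y _ hX hY hlt => hI X Y hX hY (by omega)) hdep
  have hBA' : (rk B + 2 ≤ #B ∨ ¬ rk A + 2 ≤ #A) → gap A B ≤ weight A B α₀ β₀ ∨ (dir A ≤ dir B ∧ #B < #A) := by
    intro hdep
    rw [gap_comm, weight_comm]
    exact hBA hdep
  -- The exceptional alternatives for the two orders contradict each other: one needs `#A < #B`, the
  -- other `#B < #A`. Inclusion of directions supplies the dependence needed to swap, or is already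
  -- incompatible with the cardinalities.
  by_cases hdA : rk A + 2 ≤ #A
  · rcases hAB (Or.inl hdA) with h | ⟨h1, h2⟩
    · exact h
    · have h3 : rk B ≤ rk A := Submodule.finrank_mono h1
      rcases hBA' (Or.inl (by omega)) with h | ⟨_, h5⟩
      · exact h
      · omega
  by_cases hdB : rk B + 2 ≤ #B
  · rcases hBA' (Or.inl hdB) with h | ⟨h1, h2⟩
    · exact h
    · have h3 : rk A ≤ rk B := Submodule.finrank_mono h1
      omega
  · rcases hAB (Or.inr hdB) with h | ⟨_, h2⟩
    · exact h
    · rcases hBA' (Or.inr hdA) with h | ⟨_, h4⟩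
      · exact h
      · omega

end

section

/-! ### Unnormalised weights -/

section Masses

variable {E : Type*} [AddCommGroup E] [Module ℝ E] [FiniteDimensional ℝ E] [DecidableEq E]
  {A B : Finset E} {α β : E → ℝ}

lemma gap_mul_le_weight (hα : ∀ x ∈ A, 0 ≤ α x) (hβ : ∀ y ∈ B, 0 ≤ β y)
    (h : ∑ x ∈ A, α x = ∑ y ∈ B, β y) : gap A B * ∑ y ∈ B, β y ≤ weight A B α β := by
  rcases (sum_nonneg hβ).eq_or_lt with h0 | hpos
  · rw [← h0, mul_zero]
    exact sum_nonneg fun z hz => val_nonneg hα hβ hz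
  · have h1 : IsWt A fun x => (∑ y ∈ B, β y)⁻¹ * α x :=
      ⟨fun x hx => mul_nonneg (inv_nonneg.2 hpos.le) (hα x hx), by
        rw [← mul_sum, h, inv_mul_cancel₀ hpos.ne']⟩
    have h2 : IsWt B fun y => (∑ y ∈ B, β y)⁻¹ * β y :=
      ⟨fun y hy => mul_nonneg (inv_nonneg.2 hpos.le) (hβ y hy), by
        rw [← mul_sum, inv_mul_cancel₀ hpos.ne']⟩
    have h3 := (gap_le_weight h1 h2).trans (weight_smul_le (inv_nonneg.2 hpos.le))
    rwa [inv_mul_eq_div, le_div_iff₀ hpos] at h3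

/-- Truncating the heavier weight function. -/
lemma gap_mul_add_le_weight (hB : B.Nonempty) (hα : ∀ x ∈ A, 0 ≤ α x) (hβ : ∀ y ∈ B, 0 ≤ β y)
    (h : ∑ y ∈ B, β y ≤ ∑ x ∈ A, α x) :
    gap A B * ∑ y ∈ B, β y + (∑ x ∈ A, α x - ∑ y ∈ B, β y) ≤ weight A B α β := by
  -- Cut `α` at the level that equalises the masses; the level exists by continuity.
  obtain ⟨s, hs, hsum⟩ : ∃ s, 0 ≤ s ∧ ∑ x ∈ A, min (α x) s = ∑ y ∈ B, β y := by
    have hcont : ContinuousOn (fun s : ℝ => ∑ x ∈ A, min (α x) s)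
        (Set.Icc 0 (∑ x ∈ A, α x)) := by fun_prop
    have h0 : ∑ x ∈ A, min (α x) 0 = 0 := sum_eq_zero fun x hx => min_eq_right (hα x hx)
    have h1 : ∑ x ∈ A, min (α x) (∑ x ∈ A, α x) = ∑ x ∈ A, α x :=
      sum_congr rfl fun x hx => min_eq_left (single_le_sum hα hx)
    have hmem : ∑ y ∈ B, β y ∈ Set.Icc (∑ x ∈ A, min (α x) 0)
        (∑ x ∈ A, min (α x) (∑ x ∈ A, α x)) := by
      rw [h0, h1]
      exact ⟨sum_nonneg hβ, h⟩
    obtain ⟨s, hs, he⟩ := intermediate_value_Icc (sum_nonneg hα) hcont hmem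
    exact ⟨s, hs.1, he⟩
  have hα' : ∀ x ∈ A, 0 ≤ min (α x) s := fun x hx => le_min (hα x hx) hs
  have h1 := gap_mul_le_weight hα' hβ hsum
  -- The mass cut off is regained along the translate by a maximum of `β`: there the truncated value
  -- is at most `s + β y₀`.
  obtain ⟨y₀, hy₀, hmax⟩ := exists_max_image B β hB
  have hsub : A.image (· + y₀) ⊆ A + B := by
    intro z hz
    obtain ⟨x, hx, rfl⟩ := mem_image.1 hz
    exact add_mem_add hx hy₀
  have hmono : ∀ z ∈ A + B, val A B (fun x => min (α x) s) β z ≤ val A B α β z := fun z hz =>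
    val_mono (fun x _ => min_le_left _ _) (fun _ _ => le_rfl) hz
  have h2 : ∑ x ∈ A, (α x - min (α x) s) ≤
      ∑ z ∈ A + B, (val A B α β z - val A B (fun x => min (α x) s) β z) := by
    calc ∑ x ∈ A, (α x - min (α x) s)
        ≤ ∑ x ∈ A, (val A B α β (x + y₀) - val A B (fun x => min (α x) s) β (x + y₀)) := by
          refine sum_le_sum fun x hx => ?_
          rcases le_total (α x) s with hxs | hxs
          · rw [min_eq_left hxs, sub_self]
            exact sub_nonneg.2 (hmono _ (add_mem_add hx hy₀))
          · rw [min_eq_right hxs]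
            have h3 := le_val (α := α) (β := β) hx hy₀ rfl
            have h4 : val A B (fun x => min (α x) s) β (x + y₀) ≤ s + β y₀ :=
              (val_le_iff (add_mem_add hx hy₀)).2 fun x' _ y' hy' _ =>
                add_le_add (min_le_right _ _) (hmax y' hy')
            linarith
      _ = ∑ z ∈ A.image (· + y₀), (val A B α β z - val A B (fun x => min (α x) s) β z) :=
          (sum_image (f := fun z => val A B α β z - val A B (fun x => min (α x) s) β z)
            fun x _ x' _ hxx => add_right_cancel hxx).symm
      _ ≤ _ := sum_le_sum_of_subset_of_nonneg hsub fun z hz _ => sub_nonneg.2 (hmono z hz)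
  rw [sum_sub_distrib, sum_sub_distrib, hsum] at h2
  unfold weight at h1 ⊢
  linarith

end Masses

/-! ### Sumsets and linear projections -/

section Projection

variable {E H : Type*} [AddCommGroup E] [Module ℝ E] [AddCommGroup H] [Module ℝ H] [DecidableEq H]

/-- The weight `|π⁻¹(x) ∩ A| - 1/2` of a point of the projection. -/
def fiberWt (f : E →ₗ[ℝ] H) (A : Finset E) (x : H) : ℝ := #(A.filter fun a => f a = x) - 1 / 2

lemma fiberWt_nonneg (f : E →ₗ[ℝ] H) (A : Finset E) {x : H} (hx : x ∈ A.image f) :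
    0 ≤ fiberWt f A x := by
  obtain ⟨a, ha, rfl⟩ := mem_image.1 hx
  have h : 1 ≤ #(A.filter fun b => f b = f a) := card_pos.2 ⟨a, mem_filter.2 ⟨ha, rfl⟩⟩
  have h' : (1 : ℝ) ≤ #(A.filter fun b => f b = f a) := by exact_mod_cast h
  unfold fiberWt
  linarith

lemma sum_fiberWt (f : E →ₗ[ℝ] H) (A : Finset E) :
    ∑ x ∈ A.image f, fiberWt f A x = #A - #(A.image f) / 2 := by
  unfold fiberWt
  rw [sum_sub_distrib, card_eq_sum_card_image f A, sum_const, nsmul_eq_mul]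
  push_cast
  ring

lemma dir_image (f : E →ₗ[ℝ] H) (A : Finset E) : dir (A.image f) = (dir A).map f := by
  have h := AffineMap.map_vectorSpan f.toAffineMap (s := (A : Set E))
  rw [dir, coe_image]
  exact h.symm

variable [DecidableEq E]

/-- The loss of 1 in the torsion-free Cauchy–Davenport bound is split evenly between the two fibres,
which explains the 1/2 in `fiberWt`. -/
lemma weight_fiberWt_le (f : E →ₗ[ℝ] H) (A B : Finset E) :
    weight (A.image f) (B.image f) (fiberWt f A) (fiberWt f B) ≤ #(A + B) := by
  have him : (A + B).image f = A.image f + B.image f := image_add f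
  rw [card_eq_sum_card_image f (A + B), him, weight]
  push_cast
  refine sum_le_sum fun z hz => (val_le_iff hz).2 fun x hx y hy hxy => ?_
  have hAx : (A.filter fun a => f a = x).Nonempty := by
    obtain ⟨a, ha, rfl⟩ := mem_image.1 hx
    exact ⟨a, mem_filter.2 ⟨ha, rfl⟩⟩
  have hBy : (B.filter fun a => f a = y).Nonempty := by
    obtain ⟨a, ha, rfl⟩ := mem_image.1 hy
    exact ⟨a, mem_filter.2 ⟨ha, rfl⟩⟩
  have : IsAddTorsionFree E := ⟨fun n hn u w h => by
    have h' : (n : ℝ) • u = (n : ℝ) • w := by simpa only [Nat.cast_smul_eq_nsmul] using h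
    exact smul_right_injective E (Nat.cast_ne_zero.2 hn) h'⟩
  have h1 := cauchy_davenport_of_isAddTorsionFree hAx hBy
  have h2 : (A.filter fun a => f a = x) + (B.filter fun a => f a = y) ⊆
      (A + B).filter fun a => f a = z := by
    intro w hw
    obtain ⟨a, ha, b, hb, rfl⟩ := mem_add.1 hw
    obtain ⟨ha1, ha2⟩ := mem_filter.1 ha
    obtain ⟨hb1, hb2⟩ := mem_filter.1 hb
    exact mem_filter.2 ⟨add_mem_add ha1 hb1, by rw [map_add, ha2, hb2, hxy]⟩
  have h3 : #(A.filter fun a => f a = x) + #(B.filter fun a => f a = y) ≤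
      #((A + B).filter fun a => f a = z) + 1 := by
    have := card_le_card h2
    omega
  have h4 : (#(A.filter fun a => f a = x) : ℝ) + #(B.filter fun a => f a = y) ≤
      #((A + B).filter fun a => f a = z) + 1 := by exact_mod_cast h3
  unfold fiberWt
  linarith

/-- The sumset bound obtained from the gap theorem for a projection whose images are not both
affinely independent. -/
lemma card_add_ge_of_image_dep [FiniteDimensional ℝ H] (f : E →ₗ[ℝ] H) {A B : Finset E}
    (hA : A.Nonempty) (hB : B.Nonempty) (hBA : #B ≤ #A) {d : ℕ}
    (hd : finrank ℝ H + 1 = d) (htop : dir (A.image f) = ⊤)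
    (hdep : rk (A.image f) + 2 ≤ #(A.image f) ∨ rk (B.image f) + 2 ≤ #(B.image f)) :
    (#A : ℝ) + (d + 1 / 6) * #B ≤ #(A + B) + (d + 1) * (#(A.image f) + #(B.image f)) := by
  have hw := weight_fiberWt_le f A B
  have hgap : gap (A.image f) (B.image f) = d + 1 + 1 / 6 := by
    rw [gap, if_pos hdep, htop, top_sup_eq, finrank_top, ← hd]
    push_cast
    ring
  have hα := fun x hx => fiberWt_nonneg f A (x := x) hx
  have hβ := fun x hx => fiberWt_nonneg f B (x := x) hx
  have hBA' : (#B : ℝ) ≤ #A := by exact_mod_cast hBA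
  have ha : (0 : ℝ) ≤ #(A.image f) := by positivity
  have hb : (0 : ℝ) ≤ #(B.image f) := by positivity
  have hd0 : (0 : ℝ) ≤ d := by positivity
  have hda := mul_nonneg hd0 ha
  have hdb := mul_nonneg hd0 hb
  rcases le_total (∑ y ∈ B.image f, fiberWt f B y) (∑ x ∈ A.image f, fiberWt f A x) with h | h
  · have h1 := (gap_mul_add_le_weight (hB.image f) hα hβ h).trans hw
    rw [hgap, sum_fiberWt, sum_fiberWt] at h1
    linarith
  · rw [weight_comm] at hw
    have h1 := (gap_mul_add_le_weight (hA.image f) hβ hα h).trans hw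
    rw [gap_comm, hgap] at h1
    rw [sum_fiberWt] at h1 h
    -- Here `B` has the larger fibre mass although `#B ≤ #A`, so the cardinalities differ by at most
    -- half of `#(A.image f)` and the main terms may be exchanged.
    have h2 : 0 ≤ ((d : ℝ) + 1 / 6) * (#A - #B) := mul_nonneg (by linarith) (by linarith)
    linarith

end Projection

/-! ### Orthogonal projections in Euclidean space and the dichotomy -/

lemma affDim_coe {d : ℕ} (A : Finset (EuclideanSpace ℝ (Fin d))) :
    affDim (A : Set (EuclideanSpace ℝ (Fin d))) = rk A := by
  rw [affDim, direction_affineSpan, rk]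

/-- The projection along `v` as a linear map. -/
def projₗ {d : ℕ} (v : EuclideanSpace ℝ (Fin d)) :
    EuclideanSpace ℝ (Fin d) →ₗ[ℝ] hyperplane v :=
  ((hyperplane v).orthogonalProjectionOnto : EuclideanSpace ℝ (Fin d) →ₗ[ℝ] hyperplane v)

lemma coe_projₗ {d : ℕ} (v : EuclideanSpace ℝ (Fin d)) : ⇑(projₗ v) = proj v := rfl

lemma ker_projₗ {d : ℕ} (v : EuclideanSpace ℝ (Fin d)) :
    LinearMap.ker (projₗ v) = Submodule.span ℝ {v} := by
  rw [projₗ, Submodule.ker_orthogonalProjectionOnto, hyperplane, Submodule.orthogonal_orthogonal]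

lemma range_projₗ {d : ℕ} (v : EuclideanSpace ℝ (Fin d)) : LinearMap.range (projₗ v) = ⊤ := by
  rw [LinearMap.range_eq_top]
  intro x
  exact ⟨x, Submodule.orthogonalProjectionOnto_mem_subspace_eq_self x⟩

lemma finrank_hyperplane {d : ℕ} {v : EuclideanSpace ℝ (Fin d)} (hv : v ≠ 0) :
    finrank ℝ (hyperplane v) + 1 = d := by
  have h := Submodule.finrank_add_finrank_orthogonal (Submodule.span ℝ {v})
  rw [finrank_span_singleton hv, finrank_euclideanSpace, Fintype.card_fin, add_comm] at h
  exact h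

/-- If two points of `B` have the same projection along `v`, the projection decreases the rank. -/
lemma rk_image_projₗ_add_one {d : ℕ} {v : EuclideanSpace ℝ (Fin d)} (hv : v ≠ 0)
    [DecidableEq (hyperplane v)] {B : Finset (EuclideanSpace ℝ (Fin d))}
    {y y' : EuclideanSpace ℝ (Fin d)} (hy : y ∈ B) (hy' : y' ∈ B) (hne : y ≠ y')
    (h : projₗ v y = projₗ v y') : rk (B.image (projₗ v)) + 1 = rk B := by
  classical
  have h1 := LinearMap.finrank_range_add_finrank_ker ((projₗ v).domRestrict (dir B))
  rw [LinearMap.range_domRestrict, ← dir_image] at h1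
  -- The difference of the two points is a nonzero multiple of `v`, so `dir B` contains the whole
  -- kernel line.
  have h2 : finrank ℝ (LinearMap.ker ((projₗ v).domRestrict (dir B))) = 1 := by
    have hmap : (LinearMap.ker ((projₗ v).domRestrict (dir B))).map (dir B).subtype =
        Submodule.span ℝ {v} := by
      have hyker : y - y' ∈ Submodule.span ℝ {v} := by
        rw [← ker_projₗ, LinearMap.mem_ker, map_sub, h, sub_self]
      obtain ⟨c, hc⟩ := Submodule.mem_span_singleton.1 hyker
      have hc0 : c ≠ 0 := by
        rintro rfl
        rw [zero_smul] at hc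
        exact hne (sub_eq_zero.1 hc.symm)
      have hvB : v ∈ dir B := by
        have := (dir B).smul_mem c⁻¹ (sub_mem_dir hy hy')
        rwa [← hc, smul_smul, inv_mul_cancel₀ hc0, one_smul] at this
      ext w
      rw [← ker_projₗ, Submodule.mem_map]
      constructor
      · rintro ⟨⟨u, hu⟩, huk, rfl⟩
        exact huk
      · intro hw
        have hwB : w ∈ dir B := by
          rw [ker_projₗ] at hw
          obtain ⟨e, rfl⟩ := Submodule.mem_span_singleton.1 hw
          exact (dir B).smul_mem e hvB
        exact ⟨⟨w, hwB⟩, hw, rfl⟩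
    rw [← finrank_span_singleton (K := ℝ) hv, ← hmap]
    exact (LinearEquiv.finrank_eq (Submodule.equivMapOfInjective _
      (dir B).injective_subtype _))
  rw [h2] at h1
  exact h1

/-- The dichotomy for a single direction. -/
lemma directionDichotomy_of_card_le {d : ℕ} {C : ℝ} {A B : Finset (EuclideanSpace ℝ (Fin d))}
    (hA : A.Nonempty) (hB : B.Nonempty) (hAd : rk A = d) (hBA : #B ≤ #A)
    (hAB : (((A : Set (EuclideanSpace ℝ (Fin d))) + (B : Set (EuclideanSpace ℝ (Fin d)))).ncard : ℝ)
      ≤ #A + ((d : ℝ) + 1 / 7) * #B - C)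
    {v : EuclideanSpace ℝ (Fin d)} (hv : v ≠ 0) :
    DirectionDichotomy (42 * (d + 1 + |C|)) (A : Set (EuclideanSpace ℝ (Fin d))) B v := by
  classical
  have hnc : ∀ S : Finset (EuclideanSpace ℝ (Fin d)),
      (proj v '' (S : Set (EuclideanSpace ℝ (Fin d)))).ncard = #(S.image (projₗ v)) := by
    intro S
    rw [← coe_projₗ, ← coe_image, Set.ncard_coe_finset]
  rw [← coe_add, Set.ncard_coe_finset] at hAB
  have hH := finrank_hyperplane hv
  have htopA : dir A = ⊤ := Submodule.eq_top_of_finrank_eq (by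
    rw [finrank_euclideanSpace, Fintype.card_fin]; exact hAd)
  have htop : dir (A.image (projₗ v)) = ⊤ := by
    rw [dir_image, htopA, Submodule.map_top, range_projₗ]
  have hA1 := rk_add_one_le_card (hA.image (projₗ v))
  have hB1 := rk_add_one_le_card (hB.image (projₗ v))
  have hpos : (1 : ℝ) ≤ #(A.image (projₗ v)) := by exact_mod_cast (hA.image _).card_pos
  have hpos' : (1 : ℝ) ≤ #(B.image (projₗ v)) := by exact_mod_cast (hB.image _).card_pos
  have hC := neg_abs_le C
  have hd0 : (0 : ℝ) ≤ d := by positivity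
  unfold DirectionDichotomy
  rw [hnc, hnc, affDim_coe, Set.ncard_coe_finset]
  by_cases hdep : rk (A.image (projₗ v)) + 2 ≤ #(A.image (projₗ v)) ∨
      rk (B.image (projₗ v)) + 2 ≤ #(B.image (projₗ v))
  · right
    have h := card_add_ge_of_image_dep (projₗ v) hA hB hBA hH htop hdep
    have h2 : |C| ≤ |C| * (#(A.image (projₗ v)) + #(B.image (projₗ v))) :=
      le_mul_of_one_le_right (abs_nonneg C) (by linarith)
    -- Since 1/6 - 1/7 = 1/42, the two bounds on `#(A + B)` give `#B / 42 ≤ (d + 1) * (a + b) - C`,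
    -- with `a` and `b` the image sizes; as `a + b ≥ 1`, `-C` is absorbed into `|C| * (a + b)`.
    linarith
  · rw [not_or] at hdep
    by_cases hinj : ∃ y ∈ B, ∃ y' ∈ B, y ≠ y' ∧ projₗ v y = projₗ v y'
    · left
      obtain ⟨y, hy, y', hy', hne, he⟩ := hinj
      have h1 := rk_image_projₗ_add_one hv hy hy' hne he
      have h2 : rk (A.image (projₗ v)) = finrank ℝ (hyperplane v) := by
        rw [rk, htop, finrank_top]
      -- An independent set has one point more than its rank: the ranks are `d - 1` for the image of
      -- `A` and `rk B - 1` for that of `B`.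
      exact ⟨by omega, Or.inr (by omega)⟩
    · right
      push Not at hinj
      have hcard : #(B.image (projₗ v)) = #B := by
        refine card_image_of_injOn fun y hy y' hy' he => ?_
        by_contra hne
        exact hinj y hy y' hy' hne he
      rw [hcard] at hpos' ⊢
      have hK : (1 : ℝ) ≤ 42 * (d + 1 + |C|) := by linarith [abs_nonneg C]
      have h3 := mul_le_mul_of_nonneg_right hK
        (by linarith : (0 : ℝ) ≤ #(A.image (projₗ v)) + #B)
      linarith

end

end SumsetGap

end

theorem mainTheorem6 (d : ℕ) (hd : 1 ≤ d) (C : ℝ) :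
    ∃ K : ℝ, ∀ A B : Set (EuclideanSpace ℝ (Fin d)),
      A.Finite → B.Finite → A.Nonempty → B.Nonempty →
      affDim A = d → B.ncard ≤ A.ncard →
      ((A + B).ncard : ℝ) ≤ (A.ncard : ℝ) + ((d : ℝ) + 1 / 7) * (B.ncard : ℝ) - C →
      (∀ v : EuclideanSpace ℝ (Fin d), v ≠ 0 → DirectionDichotomy K A B v) ∧
        ∃ v : EuclideanSpace ℝ (Fin d), v ≠ 0 ∧ DirectionDichotomy K A B v := by
  refine ⟨42 * (d + 1 + |C|), fun A B hA hB hAne hBne hAd hBA hAB => ?_⟩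
  lift A to Finset (EuclideanSpace ℝ (Fin d)) using hA
  lift B to Finset (EuclideanSpace ℝ (Fin d)) using hB
  rw [Set.ncard_coe_finset, Set.ncard_coe_finset] at hBA hAB
  rw [SumsetGap.affDim_coe] at hAd
  have hall : ∀ v : EuclideanSpace ℝ (Fin d), v ≠ 0 →
      DirectionDichotomy (42 * (d + 1 + |C|)) (A : Set (EuclideanSpace ℝ (Fin d))) B v :=
    fun v hv => SumsetGap.directionDichotomy_of_card_le (Finset.coe_nonempty.1 hAne)
      (Finset.coe_nonempty.1 hBne) hAd hBA hAB hv
  -- Positive dimension makes the space nontrivial, which supplies a nonzero direction for the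
  -- existential half.
  have : NeZero d := ⟨by omega⟩
  obtain ⟨v, hv⟩ := exists_ne (0 : EuclideanSpace ℝ (Fin d))
  exact ⟨hall, v, hv, hall v hv⟩
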